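/- Let $V$ be a real-valued potential of the Faddeev–Marchenko class, $\int_{\mathbb R}(1+|t|)|V(t)|\,dt<\infty$, and assume that $V$ is resonant: there is a nontrivial solution $y$ of $-y''+Vy=0$ that is bounded on all of $\mathbb R$ (a half-bound state). Then every half-bound state $y$ has finite nonzero limits $y(\pm\infty)$, and there is a real number $\theta\neq 0$ with $\theta=y(+\infty)/y(-\infty)$ for every half-bound state $y$. Equivalently, $f_-=\theta f_+$, where $f_\pm$ are the solutions of $-f''+Vf=0$ with $f_\pm(x)\to1$ as $x\to\pm\infty$. Let $\rho:\mathbb R\to(0,\infty)$ be any even continuous function that is strictly increasing on $(0,\infty)$ and satisfies $\rho(x)/|x|\to\infty$ as $|x|\to\infty$ and $\int_{\mathbb R}\rho|V|<\infty$. For small $\varepsilon>0$ let $\xi_\varepsilon>0$ be the solution of $\rho(\xi_\varepsilon)=1/\varepsilon$, and put $x_\varepsilon=\varepsilon\xi_\varepsilon$ and $$\widetilde S_\varepsilon=-\frac{d^2}{dx^2}+\varepsilon^{-2}V(x/\varepsilon)\,\chi_{[-x_\varepsilon,x_\varepsilon]}(x).$$ Then for every nonzero $k\in\mathbb C$ the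 following holds. For all sufficiently small $\varepsilon>0$ the right Jost solution of $\widetilde S_\varepsilon$, that is, the solution $\widetilde f_+$ of $\widetilde S_\varepsilon \widetilde f_+=k^2\widetilde f_+$ that is asymptotic to $e^{ikx}$ as $x\to+\infty$ (with $\widetilde f_+(x)-e^{ikx}=o(e^{-|\mathrm{Im}\,k|x})$; for $\mathrm{Im}\,k\ge0$ this is the usual $e^{-ikx}\widetilde f_+(x)\to1$), exists and equals $a_\varepsilon e^{ikx}+b_\varepsilon e^{-ikx}$ for $x<-x_\varepsilon$ with uniquely determined coefficients $a_\varepsilon,b_\varepsilon\in\mathbb C$. Moreover $a_\varepsilon\ne0$ for all sufficiently small $\varepsilon$, and the reflection coefficient $\widetilde r_\varepsilon(k)=b_\varepsilon/a_\varepsilon$ and the transmission coefficient $\widetilde t_\varepsilon(k)=1/a_\varepsilon$ satisfy $$\widetilde r_\varepsilon(k)\to\frac{1-\theta^2}{1+\theta^2},\qquad \widetilde t_\varepsilon(k)\to\frac{2\theta}{1+\theta^2}\qquad(\varepsilon\to0^+).$$ These limits are the reflection and transmission coefficients, defined in the same way with $x_\varepsilon$ replaced by $0$, of the operator $S(\theta)y=-y''$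 on $\mathbb R\setminus\{0\}$ with the interface conditions $y(0+)=\theta y(0-)$, $\theta y'(0+)=y'(0-)$. -/

import Mathlib

open Filter Topology MeasureTheory Asymptotics

noncomputable section

/-- Real potentials of the Faddeev-Marchenko class: `∫ (1 + |t|) |V t| dt < ∞`. -/
def FaddeevMarchenko (V : ℝ → ℝ) : Prop :=
  AEStronglyMeasurable V volume ∧ Integrable (fun t : ℝ => (1 + |t|) * |V t|) volume

/-- `f` is a solution on the line of `-f'' + q f = k² f` for a locally integrable potential `q`:
`f` is differentiable and `f'` is locally absolutely continuous with `f'' = (q - k²) f` almost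
everywhere, that is, `f'` is a primitive of `(q - k²) f`. -/
def IsSchrodingerSolution (q : ℝ → ℝ) (k : ℂ) (f : ℝ → ℂ) : Prop :=
  Differentiable ℝ f ∧
    ∀ x y : ℝ, deriv f y - deriv f x = ∫ t in x..y, ((q t : ℂ) - k ^ 2) * f t

/-- The wave `e^{ikx}`. -/
def planeWave (k : ℂ) (x : ℝ) : ℂ := Complex.exp (Complex.I * k * x)

/-- `f` is asymptotic to `e^{ikx}` at `+∞`. When `Im k ≥ 0`, the error bound
`e^{-|Im k| x}` equals `|e^{ikx}|`, so that this says precisely that `e^{-ikx} f(x) → 1`.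
When `Im k < 0`, that relation would not single out one solution, as `e^{-ikx}` is then the
decaying exponential; the error is required to be negligible with respect to it as well, which
holds exactly for `f(x) = e^{ikx}` near `+∞` if the potential vanishes there. -/
def AsympRight (k : ℂ) (f : ℝ → ℂ) : Prop :=
  (fun x : ℝ => f x - planeWave k x) =o[atTop] (fun x : ℝ => Real.exp (-(|k.im| * x)))

/-- `f` is asymptotic to `e^{-ikx}` at `-∞`, in the same sense. -/
def AsympLeft (k : ℂ) (f : ℝ → ℂ) : Prop :=
  (fun x : ℝ => f x - planeWave (-k) x) =o[atBot] (fun x : ℝ => Real.exp (|k.im| * x))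

/-- `f` is the right Jost solution `f_+(·, k)` of `-d²/dx² + q`. -/
def IsRightJost (q : ℝ → ℝ) (k : ℂ) (f : ℝ → ℂ) : Prop :=
  IsSchrodingerSolution q k f ∧ AsympRight k f

/-- `f` is the left Jost solution `f_-(·, k)` of `-d²/dx² + q`. -/
def IsLeftJost (q : ℝ → ℝ) (k : ℂ) (f : ℝ → ℂ) : Prop :=
  IsSchrodingerSolution q k f ∧ AsympLeft k f

/-- A half-bound state: a nontrivial solution of `-y'' + V y = 0` bounded on the whole line. -/
def IsHalfBoundState (V : ℝ → ℝ) (y : ℝ → ℂ) : Prop :=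
  IsSchrodingerSolution V 0 y ∧ (∃ x, y x ≠ 0) ∧ ∃ C : ℝ, ∀ x, ‖y x‖ ≤ C

/-- `V` is resonant if it has a half-bound state. -/
def IsResonant (V : ℝ → ℝ) : Prop := ∃ y : ℝ → ℂ, IsHalfBoundState V y

/-- The weights `ρ` used to choose the cut-off points for the potential `V`: even, continuous,
positive, strictly increasing on `x > 0`, with `ρ(x)/|x| → ∞` as `|x| → ∞` and
`∫ ρ |V| < ∞`. -/
structure IsCutoffWeight (V ρ : ℝ → ℝ) : Prop where
  even : ∀ x, ρ (-x) = ρ x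
  continuous : Continuous ρ
  pos : ∀ x, 0 < ρ x
  strictMonoOn : StrictMonoOn ρ (Set.Ioi 0)
  tendsto_atTop : Tendsto (fun x : ℝ => ρ x / |x|) atTop atTop
  tendsto_atBot : Tendsto (fun x : ℝ => ρ x / |x|) atBot atTop
  integrable : Integrable (fun x : ℝ => ρ x * |V x|) volume

/-- The scaled and truncated potential `ε⁻² V(x/ε) χ_{[-c, c]}(x)`. -/
def truncatedPotential (V : ℝ → ℝ) (ε c : ℝ) : ℝ → ℝ :=
  Set.indicator (Set.Icc (-c) c) (fun x : ℝ => (ε ^ 2)⁻¹ * V (x / ε))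

/-- `y` is a (not necessarily square integrable) solution of `S(θ) y = k² y`: it satisfies
`-y'' = k² y` off the origin, has one-sided limits there together with its derivative, and
`y(0+) = θ y(0-)`, `θ y'(0+) = y'(0-)`. The value of `y` at `0` itself is irrelevant. -/
def IsPointInteractionSolution (θ : ℝ) (k : ℂ) (y : ℝ → ℂ) : Prop :=
  (∀ x : ℝ, x ≠ 0 → DifferentiableAt ℝ y x ∧ HasDerivAt (deriv y) (-(k ^ 2 * y x)) x) ∧
    ∃ yp ym dp dm : ℂ,
      Tendsto y (𝓝[>] 0) (𝓝 yp) ∧ Tendsto y (𝓝[<] 0) (𝓝 ym) ∧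
      Tendsto (deriv y) (𝓝[>] 0) (𝓝 dp) ∧ Tendsto (deriv y) (𝓝[<] 0) (𝓝 dm) ∧
      yp = θ * ym ∧ θ * dp = dm

/-- The coefficients of the right Jost solution to the left of a perturbation that lives on
`[-c, c]`: among the generalized eigenfunctions `Sol` at energy `k²`, the one asymptotic to
`e^{ikx}` at `+∞` equals `a e^{ikx} + b e^{-ikx}` for `x < -c`. The reflection coefficient is then
`b / a` and the transmission coefficient is `1 / a`. -/
def HasJostCoefficients (Sol : (ℝ → ℂ) → Prop) (k : ℂ) (c : ℝ) (a b : ℂ) : Prop :=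
  ∃ f : ℝ → ℂ, Sol f ∧ AsympRight k f ∧
    ∀ x : ℝ, x < -c → f x = a * planeWave k x + b * planeWave (-k) x

end

/-!
A bounded solution `y` of `-y'' + V y = 0` tends to nonzero limits `cm`, `cp` at `∓∞`: since
`(y - x y')' = -x V y` is integrable, `y - x y'` converges, which forces `y'` to be at most the tail
integral of `V` and `y` to converge; a zero limit is excluded by the Volterra equation
(`IsLinearSolution.exists_limits`). The same argument shows that bounded solutions are proportional.
As `V` is real, the conjugate of `y` is proportional to `y`, so that `θ = cp / cm` is real
(`exists_halfBoundState_ratio`).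

In the variable `s = x / ε` the equation `S̃_ε f = k² f` becomes `u'' = (V - ε² k²) u` on `[-ξ, ξ]`.
Let `z` be a second solution at zero energy with `y z' - y' z = 1`; it grows at most linearly. By
Lagrange's identity the Wronskians of `u` with `y` and `z` change on `[-ξ, ξ]` only by
`O(ε² ξ)` and `O(ε² ξ (1 + ξ))` times the maximum of `u`, and Cramer's rule bounds this maximum by
the Wronskians at `ξ` as soon as `ε ξ` is small (`IsLinearSolution.wronskian_almost_constant`).
Because the weight exceeds `1 / ε` beyond `ξ`, the tails of `V` and hence `y'(± ξ)` are `o(ε)`. So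
the Wronskian of `y` and `u`, divided by `ε`, has the same limit at `ξ`, where it is `cp · ik`, and
at `-ξ`, where it is `cm · lim u' / ε`. Likewise `u(-ξ) → cm / cp` (`tendsto_cauchyData`). In the
limit the Cauchy data thus satisfy exactly the interface conditions of `S(θ)`, and the scattering
coefficients are read off from the data at `-ξ`.

Solutions are understood in the sense of Carathéodory. The global existence theorem
`exists_linear_integral_equation` is a contraction argument in a weighted supremum norm; uniqueness
follows from existence and the constancy of Wronskians (`IsLinearSolution.eq_zero`).
-/

open scoped BoundedContinuousFunction

/-! ### Indefinite integrals and linear equations of second order -/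

/-- `F` is an indefinite integral of the locally integrable function `f`, that is, `F` is locally
absolutely continuous with `F' = f` almost everywhere. -/
structure IsPrimitive (F f : ℝ → ℂ) : Prop where
  locallyIntegrable : LocallyIntegrable f volume
  sub_eq : ∀ x y : ℝ, F y - F x = ∫ t in x..y, f t

theorem MeasureTheory.LocallyIntegrable.intervalIntegrable' {E : Type*} [NormedAddCommGroup E]
    {f : ℝ → E} (hf : LocallyIntegrable f volume) (a b : ℝ) : IntervalIntegrable f volume a b :=
  intervalIntegrable_iff.mpr <|
    (hf.integrableOn_isCompact isCompact_uIcc).mono_set Set.uIoc_subset_uIcc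

namespace IsPrimitive

variable {F f G g : ℝ → ℂ}

theorem eq_add (h : IsPrimitive F f) (x y : ℝ) : F y = F x + ∫ t in x..y, f t := by
  rw [← h.sub_eq]; ring

theorem absolutelyContinuous (h : IsPrimitive F f) (a b : ℝ) :
    AbsolutelyContinuousOnInterval F a b := by
  have hn : LocallyIntegrable (fun t => ‖f t‖) volume := fun x => (h.locallyIntegrable x).norm
  have hG := (hn.intervalIntegrable' a b).absolutelyContinuousOnInterval_intervalIntegral
    (c := a) (by simp)
  refine squeeze_zero (fun E => Finset.sum_nonneg fun i _ => dist_nonneg)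
    (fun E => Finset.sum_le_sum fun i _ => ?_) hG
  rw [dist_comm, dist_eq_norm, h.sub_eq, dist_comm, Real.dist_eq,
    intervalIntegral.integral_interval_sub_left (hn.intervalIntegrable' _ _)
      (hn.intervalIntegrable' _ _)]
  exact intervalIntegral.norm_integral_le_abs_integral_norm

theorem continuous (h : IsPrimitive F f) : Continuous F := by
  have : F = fun y => F 0 + ∫ t in (0 : ℝ)..y, f t := funext fun y => h.eq_add 0 y
  rw [this]
  exact continuous_const.add
    (intervalIntegral.continuous_primitive (fun a b => h.locallyIntegrable.intervalIntegrable' a b) 0)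

theorem ae_hasDerivAt (h : IsPrimitive F f) : ∀ᵐ x, HasDerivAt F (f x) x := by
  have : F = fun y => F 0 + ∫ t in (0 : ℝ)..y, f t := funext fun y => h.eq_add 0 y
  rw [this]
  filter_upwards [LocallyIntegrable.ae_hasDerivAt_integral h.locallyIntegrable] with x hx
  exact (hx 0).const_add _

/-- Lebesgue's characterization of indefinite integrals. -/
theorem of_ae_hasDerivAt (hac : ∀ a b, AbsolutelyContinuousOnInterval F a b)
    (hf : LocallyIntegrable f volume) (hd : ∀ᵐ x, HasDerivAt F (f x) x) : IsPrimitive F f := by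
  refine ⟨hf, fun x y => ?_⟩
  have hI : IsPrimitive (fun y => ∫ t in x..y, f t) f :=
    ⟨hf, fun a b => intervalIntegral.integral_interval_sub_left
      (hf.intervalIntegrable' _ _) (hf.intervalIntegrable' _ _)⟩
  have h0 : ∀ᵐ s, s ∈ Set.uIcc x y → HasDerivAt (F - fun y => ∫ t in x..y, f t) 0 s := by
    filter_upwards [hd, hI.ae_hasDerivAt] with s h1 h2 _
    simpa using h1.sub h2
  obtain ⟨C, hC⟩ :=
    ((hac x y).sub (hI.absolutelyContinuous x y)).const_of_ae_hasDerivAt_zero h0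
  have h1 := hC x (by simp)
  have h2 := hC y (by simp)
  simp only [Pi.sub_apply, intervalIntegral.integral_same, sub_zero] at h1 h2
  rw [h1, ← h2]; ring

theorem of_hasDerivAt (hf : Continuous f) (hd : ∀ x, HasDerivAt F (f x) x) : IsPrimitive F f :=
  ⟨hf.locallyIntegrable, fun _ _ => (intervalIntegral.integral_eq_sub_of_hasDerivAt
    (fun t _ => hd t) (hf.intervalIntegrable _ _)).symm⟩

theorem mul (hF : IsPrimitive F f) (hG : IsPrimitive G g) :
    IsPrimitive (fun x => F x * G x) (fun x => f x * G x + F x * g x) := by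
  refine of_ae_hasDerivAt (fun a b => ?_) ?_ ?_
  · exact (hF.absolutelyContinuous a b).smul (hG.absolutelyContinuous a b)
  · exact (hF.locallyIntegrable.mul_continuous hG.continuous).add
      (hG.locallyIntegrable.continuous_mul hF.continuous)
  · filter_upwards [hF.ae_hasDerivAt, hG.ae_hasDerivAt] with x h1 h2
    exact h1.mul h2

theorem sub (hF : IsPrimitive F f) (hG : IsPrimitive G g) :
    IsPrimitive (fun x => F x - G x) (fun x => f x - g x) :=
  ⟨hF.locallyIntegrable.sub hG.locallyIntegrable, fun x y => by
    rw [intervalIntegral.integral_sub (hF.locallyIntegrable.intervalIntegrable' _ _)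
      (hG.locallyIntegrable.intervalIntegrable' _ _), ← hF.sub_eq, ← hG.sub_eq]; ring⟩

theorem add (hF : IsPrimitive F f) (hG : IsPrimitive G g) :
    IsPrimitive (fun x => F x + G x) (fun x => f x + g x) :=
  ⟨hF.locallyIntegrable.add hG.locallyIntegrable, fun x y => by
    rw [intervalIntegral.integral_add (hF.locallyIntegrable.intervalIntegrable' _ _)
      (hG.locallyIntegrable.intervalIntegrable' _ _), ← hF.sub_eq, ← hG.sub_eq]; ring⟩

theorem congr (hF : IsPrimitive F f) (h : ∀ x, f x = g x) : IsPrimitive F g := by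
  rwa [← funext h]

end IsPrimitive

/-- `f` solves `f'' = P f` on the line for the locally integrable coefficient `P`: `f` is
differentiable and `f'` is an indefinite integral of `P f`. -/
def IsLinearSolution (P f : ℝ → ℂ) : Prop :=
  Differentiable ℝ f ∧ ∀ x y : ℝ, deriv f y - deriv f x = ∫ t in x..y, P t * f t

namespace IsLinearSolution

variable {P Q f g : ℝ → ℂ}

theorem continuous (h : IsLinearSolution P f) : Continuous f := h.1.continuous

theorem hasDerivAt (h : IsLinearSolution P f) (x : ℝ) : HasDerivAt f (deriv f x) x :=
  (h.1 x).hasDerivAt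

theorem isPrimitive_deriv (hP : LocallyIntegrable P volume) (h : IsLinearSolution P f) :
    IsPrimitive (deriv f) (fun t => P t * f t) :=
  ⟨hP.mul_continuous h.continuous, h.2⟩

theorem continuous_deriv (hP : LocallyIntegrable P volume) (h : IsLinearSolution P f) :
    Continuous (deriv f) := (h.isPrimitive_deriv hP).continuous

theorem isPrimitive (hP : LocallyIntegrable P volume) (h : IsLinearSolution P f) :
    IsPrimitive f (deriv f) := .of_hasDerivAt (h.continuous_deriv hP) h.hasDerivAt

theorem of_hasDerivAt {f' : ℝ → ℂ} (hf : ∀ x, HasDerivAt f (f' x) x)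
    (hf' : ∀ x y : ℝ, f' y - f' x = ∫ t in x..y, P t * f t) : IsLinearSolution P f := by
  have : deriv f = f' := funext fun x => (hf x).deriv
  exact ⟨fun x => (hf x).differentiableAt, by rwa [this]⟩

theorem linear_combination (hP : LocallyIntegrable P volume) (hf : IsLinearSolution P f)
    (hg : IsLinearSolution P g) (a b : ℂ) : IsLinearSolution P (fun x => a * f x + b * g x) := by
  refine .of_hasDerivAt (f' := fun x => a * deriv f x + b * deriv g x)
    (fun x => ((hf.hasDerivAt x).const_mul a).add ((hg.hasDerivAt x).const_mul b)) fun x y => ?_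
  have e : ∀ t, P t * (a * f t + b * g t) = a * (P t * f t) + b * (P t * g t) := fun t => by ring
  simp only [e]
  rw [intervalIntegral.integral_add
    (((hP.mul_continuous hf.continuous).intervalIntegrable' _ _).const_mul _)
    (((hP.mul_continuous hg.continuous).intervalIntegrable' _ _).const_mul _),
    intervalIntegral.integral_const_mul, intervalIntegral.integral_const_mul, ← hf.2, ← hg.2]
  ring

theorem const_mul (hf : IsLinearSolution P f) (a : ℂ) : IsLinearSolution P (fun x => a * f x) := by
  refine .of_hasDerivAt (f' := fun x => a * deriv f x)
    (fun x => (hf.hasDerivAt x).const_mul a) fun x y => ?_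
  have e : ∀ t, P t * (a * f t) = a * (P t * f t) := fun t => by ring
  simp only [e]
  rw [intervalIntegral.integral_const_mul, ← hf.2]
  ring

theorem comp_neg (hf : IsLinearSolution P f) :
    IsLinearSolution (fun x => P (-x)) (fun x => f (-x)) := by
  refine .of_hasDerivAt (f' := fun x => -deriv f (-x)) (fun x => ?_) fun x y => ?_
  · simpa [Function.comp_def] using (hf.hasDerivAt (-x)).scomp x (hasDerivAt_neg x)
  · rw [intervalIntegral.integral_comp_neg (fun t => P t * f t), ← hf.2]; ring

/-- Rescaling the variable turns the coefficient `P` into `c² P(c ·)`. -/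
theorem comp_mul (hf : IsLinearSolution P f) (c : ℝ) :
    IsLinearSolution (fun x => (c : ℂ) ^ 2 * P (c * x)) (fun x => f (c * x)) := by
  refine .of_hasDerivAt (f' := fun x => c * deriv f (c * x)) (fun x => ?_) fun x y => ?_
  · have := (hf.hasDerivAt (c * x)).scomp x ((hasDerivAt_id x).const_mul c)
    simpa [Function.comp_def] using this
  · have := intervalIntegral.smul_integral_comp_mul_left (fun t => P t * f t) c (a := x) (b := y)
    rw [← hf.2, Complex.real_smul] at this
    simp only [pow_two, mul_assoc, intervalIntegral.integral_const_mul]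
    rw [this]; ring

end IsLinearSolution

/-- The Wronskian `f g' - f' g`. -/
noncomputable def wronskian (f g : ℝ → ℂ) (x : ℝ) : ℂ := f x * deriv g x - deriv f x * g x

namespace IsLinearSolution

variable {P Q f g : ℝ → ℂ}

/-- Lagrange's identity. -/
theorem isPrimitive_wronskian (hP : LocallyIntegrable P volume) (hQ : LocallyIntegrable Q volume)
    (hf : IsLinearSolution P f) (hg : IsLinearSolution Q g) :
    IsPrimitive (wronskian f g) (fun t => (Q t - P t) * (f t * g t)) := by
  refine IsPrimitive.congr (((hf.isPrimitive hP).mul (hg.isPrimitive_deriv hQ)).sub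
    ((hf.isPrimitive_deriv hP).mul (hg.isPrimitive hQ))) fun x => ?_
  ring

theorem wronskian_eq (hP : LocallyIntegrable P volume)
    (hf : IsLinearSolution P f) (hg : IsLinearSolution P g) (x y : ℝ) :
    wronskian f g y = wronskian f g x := by
  have := (hf.isPrimitive_wronskian hP hP hg).sub_eq x y
  simpa [sub_eq_zero] using this

/-- Taylor's formula with integral remainder. -/
theorem eq_add_integral (hP : LocallyIntegrable P volume) (hf : IsLinearSolution P f) (a x : ℝ) :
    f x = f a + (x - a) * deriv f a + ∫ t in a..x, ((x : ℂ) - t) * (P t * f t) := by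
  have hl : IsPrimitive (fun t : ℝ => (x : ℂ) - t) (fun _ => -1) := by
    refine .of_hasDerivAt continuous_const fun t => ?_
    simpa using (Complex.ofRealCLM.hasDerivAt (x := t)).const_sub (x : ℂ)
  have h := ((hf.isPrimitive hP).add (hl.mul (hf.isPrimitive_deriv hP))).congr
    (g := fun t : ℝ => ((x : ℂ) - t) * (P t * f t)) fun t => by ring
  rw [← h.sub_eq]; ring

end IsLinearSolution

/-! ### Solvability with locally integrable coefficients -/

theorem MeasureTheory.LocallyIntegrable.clm_apply_continuous {E : Type*} [NormedAddCommGroup E]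
    [NormedSpace ℝ E] {A : ℝ → E →L[ℝ] E} (hA : LocallyIntegrable A volume) {g : ℝ → E}
    (hg : Continuous g) : LocallyIntegrable (fun t => A t (g t)) volume := by
  rw [locallyIntegrable_iff]
  intro K hK
  obtain ⟨C, hC⟩ := hK.exists_bound_of_continuousOn hg.continuousOn
  have hAK := hA.integrableOn_isCompact hK
  refine Integrable.mono' (hAK.norm.mul_const C) ?_ ?_
  · exact ContinuousLinearMap.aestronglyMeasurable_comp₂ (ContinuousLinearMap.id ℝ (E →L[ℝ] E))
      hAK.aestronglyMeasurable hg.aestronglyMeasurable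
  · filter_upwards [ae_restrict_mem hK.measurableSet] with t ht
    exact (A t).le_opNorm_of_le (hC t ht)

/-- The exponential weight `exp (2 |∫ m|)` dominates twice the integral of `m` against itself. Only
this inequality is needed, and it follows from the fact that a monotone function increases by at
least the integral of its derivative. -/
theorem abs_integral_mul_exp_le {m : ℝ → ℝ} (hm : LocallyIntegrable m volume) (hm0 : ∀ t, 0 ≤ m t)
    (x₀ x : ℝ) :
    |∫ t in x₀..x, m t * Real.exp (2 * |∫ s in x₀..t, m s|)| ≤
      Real.exp (2 * |∫ s in x₀..x, m s|) / 2 := by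
  set M : ℝ → ℝ := fun t => ∫ s in x₀..t, m s with hM
  have hsub : ∀ a b, M b - M a = ∫ s in a..b, m s := fun a b =>
    intervalIntegral.integral_interval_sub_left (hm.intervalIntegrable' _ _)
      (hm.intervalIntegrable' _ _)
  have hmono : Monotone M := fun a b hab => by
    have := intervalIntegral.integral_nonneg (μ := volume) hab fun t _ => hm0 t
    rw [← hsub] at this; linarith
  have hM0 : M x₀ = 0 := by simp [hM]
  -- the two sides of `x₀` are treated at once: there `|M| = σ M` with a constant sign `σ`
  obtain ⟨σ, hσ, hσM⟩ : ∃ σ : ℝ, (σ = 1 ∨ σ = -1) ∧ ∀ t ∈ Set.uIcc x₀ x, |M t| = σ * M t := by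
    rcases le_total x₀ x with h | h
    · refine ⟨1, Or.inl rfl, fun t ht => ?_⟩
      rw [Set.uIcc_of_le h] at ht
      rw [abs_of_nonneg (hM0 ▸ hmono ht.1), one_mul]
    · refine ⟨-1, Or.inr rfl, fun t ht => ?_⟩
      rw [Set.uIcc_of_ge h] at ht
      rw [abs_of_nonpos (hM0 ▸ hmono ht.2), neg_one_mul]
  have hσ2 : σ * σ = 1 := by rcases hσ with rfl | rfl <;> norm_num
  set Φ : ℝ → ℝ := fun t => σ * Real.exp (2 * (σ * M t)) with hΦ
  have hΦmono : Monotone Φ := fun a b hab => by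
    have := hmono hab
    rcases hσ with rfl | rfl
    · simp only [hΦ, one_mul, Real.exp_le_exp]; linarith
    · simp only [hΦ, neg_mul, one_mul, neg_le_neg_iff, Real.exp_le_exp]; linarith
  have hd : ∫ t in x₀..x, deriv Φ t = 2 * ∫ t in x₀..x, m t * Real.exp (2 * |M t|) := by
    rw [← intervalIntegral.integral_const_mul]
    apply intervalIntegral.integral_congr_ae
    filter_upwards [LocallyIntegrable.ae_hasDerivAt_integral hm] with t ht htm
    have h1 : HasDerivAt Φ (σ * (Real.exp (2 * (σ * M t)) * (2 * (σ * m t)))) t :=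
      ((((ht x₀).const_mul σ).const_mul 2).exp).const_mul σ
    rw [h1.deriv, hσM t (Set.uIoc_subset_uIcc htm)]
    linear_combination (2 * m t * Real.exp (2 * (σ * M t))) * hσ2
  have h2 := Set.abs_sub_left_of_mem_uIcc
    ((hΦmono.monotoneOn (Set.uIcc x₀ x)).intervalIntegral_deriv_mem_uIcc)
  have h3 : |Φ x - Φ x₀| ≤ Real.exp (2 * |M x|) := by
    have e : Φ x - Φ x₀ = σ * (Real.exp (2 * |M x|) - 1) := by
      simp only [hΦ, hM0, hσM x Set.right_mem_uIcc]; simp; ring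
    have h1 : 1 ≤ Real.exp (2 * |M x|) := Real.one_le_exp (by positivity)
    have hs : |σ| = 1 := by rcases hσ with rfl | rfl <;> norm_num
    rw [e, abs_mul, hs, one_mul, abs_of_nonneg (by linarith)]; linarith
  rw [hd, sub_zero, sub_zero, abs_mul, abs_two] at h2
  linarith

/-- Global solvability of linear differential equations `u' = A u` in a Banach space whose
coefficient is merely locally integrable. The integral equation is a contraction for the supremum
norm weighted by `exp (-2 |∫ ‖A‖|)`. -/
theorem exists_linear_integral_equation {E : Type*} [NormedAddCommGroup E] [NormedSpace ℝ E]
    [CompleteSpace E] {A : ℝ → E →L[ℝ] E} (hA : LocallyIntegrable A volume) (x₀ : ℝ) (u₀ : E) :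
    ∃ u : ℝ → E, Continuous u ∧ ∀ x, u x = u₀ + ∫ t in x₀..x, A t (u t) := by
  have hm : LocallyIntegrable (fun t => ‖A t‖) volume := fun x => (hA x).norm
  set w : ℝ → ℝ := fun x => Real.exp (2 * |∫ s in x₀..x, ‖A s‖|) with hw
  have hwc : Continuous w := by
    have := intervalIntegral.continuous_primitive (fun a b => hm.intervalIntegrable' a b) x₀
    fun_prop
  have hw1 : ∀ x, 1 ≤ w x := fun x => Real.one_le_exp (by positivity)
  have hw0 : ∀ x, 0 < w x := fun x => Real.exp_pos _
  have hloc : ∀ v : ℝ →ᵇ E, LocallyIntegrable (fun t => A t (w t • v t)) volume := fun v =>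
    hA.clm_apply_continuous (hwc.smul v.continuous)
  have hbound : ∀ (v : ℝ →ᵇ E) (x : ℝ),
      ‖∫ t in x₀..x, A t (w t • v t)‖ ≤ w x / 2 * ‖v‖ := fun v x => by
    have h1 : ‖∫ t in x₀..x, A t (w t • v t)‖ ≤ |∫ t in x₀..x, (‖A t‖ * w t) * ‖v‖| := by
      refine intervalIntegral.norm_integral_le_abs_of_norm_le (ae_of_all _ fun t => ?_) ?_
      · refine ((A t).le_opNorm _).trans ?_
        rw [norm_smul, Real.norm_of_nonneg (hw0 t).le, mul_assoc]
        gcongr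
        exact v.norm_coe_le_norm t
      · exact ((hm.intervalIntegrable' _ _).mul_continuousOn hwc.continuousOn).mul_const _
    rw [intervalIntegral.integral_mul_const, abs_mul, abs_norm] at h1
    refine h1.trans ?_
    gcongr
    exact abs_integral_mul_exp_le hm (fun t => norm_nonneg _) x₀ x
  let S : (ℝ →ᵇ E) → (ℝ →ᵇ E) := fun v => BoundedContinuousFunction.ofNormedAddCommGroup
    (fun x => (w x)⁻¹ • (u₀ + ∫ t in x₀..x, A t (w t • v t)))
    ((hwc.inv₀ fun x => (hw0 x).ne').smul (continuous_const.add
      (intervalIntegral.continuous_primitive (fun a b => (hloc v).intervalIntegrable' a b) x₀)))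
    (‖u₀‖ + ‖v‖ / 2) fun x => by
      rw [norm_smul, norm_inv, Real.norm_of_nonneg (hw0 x).le, inv_mul_le_iff₀ (hw0 x)]
      have := norm_add_le u₀ (∫ t in x₀..x, A t (w t • v t))
      nlinarith [hbound v x, hw1 x, norm_nonneg u₀]
  have hS : ContractingWith (1 / 2) S := by
    refine ⟨by rw [← NNReal.coe_lt_coe]; norm_num, LipschitzWith.of_dist_le_mul fun v v' => ?_⟩
    rw [BoundedContinuousFunction.dist_le (by positivity)]
    intro x
    have e : S v x - S v' x = (w x)⁻¹ • ∫ t in x₀..x, A t (w t • (v - v') t) := by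
      change (w x)⁻¹ • (u₀ + ∫ t in x₀..x, A t (w t • v t)) -
        (w x)⁻¹ • (u₀ + ∫ t in x₀..x, A t (w t • v' t)) = _
      rw [← smul_sub, add_sub_add_left_eq_sub, ← intervalIntegral.integral_sub
        ((hloc v).intervalIntegrable' _ _) ((hloc v').intervalIntegrable' _ _)]
      simp [smul_sub]
    rw [dist_eq_norm, e, norm_smul, norm_inv, Real.norm_of_nonneg (hw0 x).le,
      inv_mul_le_iff₀ (hw0 x), dist_eq_norm]
    refine (hbound (v - v') x).trans (le_of_eq ?_)
    push_cast; ring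
  have hfix := hS.fixedPoint_isFixedPt
  set v := ContractingWith.fixedPoint S hS
  refine ⟨fun x => w x • v x, hwc.smul v.continuous, fun x => ?_⟩
  have : v x = (w x)⁻¹ • (u₀ + ∫ t in x₀..x, A t (w t • v t)) := DFunLike.congr_fun hfix.symm x
  change w x • v x = _
  conv_lhs => rw [this]
  rw [smul_inv_smul₀ (hw0 x).ne']

namespace IsLinearSolution

variable {P : ℝ → ℂ}

/-- The initial value problem for `f'' = P f` is solvable on the whole line. -/
theorem exists_of_initial (hP : LocallyIntegrable P volume) (x₀ : ℝ) (a b : ℂ) :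
    ∃ f, IsLinearSolution P f ∧ f x₀ = a ∧ deriv f x₀ = b := by
  set L₁ : ℂ × ℂ →L[ℝ] ℂ × ℂ :=
    (ContinuousLinearMap.inl ℝ ℂ ℂ).comp (ContinuousLinearMap.snd ℝ ℂ ℂ) with hL₁
  -- `z ↦ ((p, q) ↦ (0, z p))`
  set L₂ : ℂ →L[ℝ] (ℂ × ℂ →L[ℝ] ℂ × ℂ) :=
    ((ContinuousLinearMap.compL ℝ (ℂ × ℂ) ℂ (ℂ × ℂ)) (ContinuousLinearMap.inr ℝ ℂ ℂ)).comp
      (((ContinuousLinearMap.compL ℝ (ℂ × ℂ) ℂ ℂ).flip (ContinuousLinearMap.fst ℝ ℂ ℂ)).comp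
        (ContinuousLinearMap.mul ℝ ℂ)) with hL₂
  have hA : LocallyIntegrable (fun t => L₁ + L₂ (P t)) volume := by
    intro x
    have hc : LocallyIntegrable (fun _ : ℝ => L₁) volume := continuous_const.locallyIntegrable
    obtain ⟨s, hs, hi⟩ := hP x
    obtain ⟨s', hs', hi'⟩ := hc x
    have h1 : Integrable (fun _ : ℝ => L₁) (volume.restrict (s' ∩ s)) :=
      hi'.mono_set Set.inter_subset_left
    have h2 : Integrable P (volume.restrict (s' ∩ s)) := hi.mono_set Set.inter_subset_right
    exact ⟨s' ∩ s, inter_mem hs' hs, h1.add (L₂.integrable_comp h2)⟩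
  obtain ⟨u, huc, hu⟩ := exists_linear_integral_equation hA x₀ (a, b)
  have hAu : ∀ t, (L₁ + L₂ (P t)) (u t) = ((u t).2, P t * (u t).1) := fun t => by
    simp [hL₁, hL₂]
  simp only [hAu] at hu
  have hi2 : LocallyIntegrable (fun t => P t * (u t).1) volume := hP.mul_continuous huc.fst
  have hint : ∀ x, IntervalIntegrable (fun t => ((u t).2, P t * (u t).1)) volume x₀ x := fun x =>
    ⟨(huc.snd.intervalIntegrable x₀ x).1.prodMk (hi2.intervalIntegrable' x₀ x).1,
      (huc.snd.intervalIntegrable x₀ x).2.prodMk (hi2.intervalIntegrable' x₀ x).2⟩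
  have h1 : ∀ x, (u x).1 = a + ∫ t in x₀..x, (u t).2 := fun x => by
    have := (ContinuousLinearMap.fst ℝ ℂ ℂ).intervalIntegral_comp_comm (hint x)
    rw [hu x, Prod.fst_add]
    exact congrArg (a + ·) this.symm
  have h2 : ∀ x, (u x).2 = b + ∫ t in x₀..x, P t * (u t).1 := fun x => by
    have := (ContinuousLinearMap.snd ℝ ℂ ℂ).intervalIntegral_comp_comm (hint x)
    rw [hu x, Prod.snd_add]
    exact congrArg (b + ·) this.symm
  have hd : ∀ x, HasDerivAt (fun x => (u x).1) ((u x).2) x := fun x => by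
    have := (intervalIntegral.integral_hasDerivAt_right (huc.snd.intervalIntegrable x₀ x)
      (huc.snd.stronglyMeasurableAtFilter _ _) huc.snd.continuousAt).const_add a
    exact this.congr_of_eventuallyEq (Eventually.of_forall h1)
  refine ⟨fun x => (u x).1, .of_hasDerivAt hd fun x y => ?_, ?_, ?_⟩
  · rw [h2 y, h2 x, add_sub_add_left_eq_sub, intervalIntegral.integral_interval_sub_left
      (hi2.intervalIntegrable' _ _) (hi2.intervalIntegrable' _ _)]
  · simpa using h1 x₀
  · rw [(hd x₀).deriv]; simpa using h2 x₀

/-- Cramer's rule for a solution in terms of two solutions with Wronskian one. -/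
theorem eq_of_wronskian_eq_one {f y z : ℝ → ℂ} {x : ℝ} (hW : wronskian y z x = 1) :
    f x = wronskian f z x * y x + wronskian y f x * z x := by
  simp only [wronskian] at *
  linear_combination -f x * hW

/-- A solution with vanishing Cauchy data is trivial: its Wronskians with a fundamental system are
constant, hence zero. -/
theorem eq_zero (hP : LocallyIntegrable P volume) {f : ℝ → ℂ} (hf : IsLinearSolution P f)
    {x₀ : ℝ} (h0 : f x₀ = 0) (h1 : deriv f x₀ = 0) (x : ℝ) : f x = 0 := by
  obtain ⟨y, hy, hy0, hy1⟩ := exists_of_initial hP x₀ 1 0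
  obtain ⟨z, hz, hz0, hz1⟩ := exists_of_initial hP x₀ 0 1
  have hW : wronskian y z x = 1 := by
    rw [wronskian_eq hP hy hz x₀ x]; simp [wronskian, hy0, hy1, hz0, hz1]
  rw [eq_of_wronskian_eq_one (f := f) hW, wronskian_eq hP hf hz x₀ x, wronskian_eq hP hy hf x₀ x]
  simp [wronskian, h0, h1]

theorem eq_of_initial (hP : LocallyIntegrable P volume) {f g : ℝ → ℂ} (hf : IsLinearSolution P f)
    (hg : IsLinearSolution P g) {x₀ : ℝ} (h0 : f x₀ = g x₀) (h1 : deriv f x₀ = deriv g x₀) :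
    f = g := by
  funext x
  have hd := hf.linear_combination hP hg 1 (-1)
  have hd' : deriv (fun x => 1 * f x + -1 * g x) x₀ = 0 := by
    have := ((hf.hasDerivAt x₀).const_mul 1).fun_add ((hg.hasDerivAt x₀).const_mul (-1))
    rw [this.deriv, h1]; ring
  have := hd.eq_zero hP (by rw [h0]; ring) hd' x
  linear_combination this

end IsLinearSolution

/-! ### Solutions at zero energy near infinity -/

/-- An indefinite integral of an integrable function converges at `+∞`. -/
theorem IsPrimitive.exists_tendsto_atTop {F f : ℝ → ℂ} (h : IsPrimitive F f) (hf : Integrable f) :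
    ∃ L, Tendsto F atTop (𝓝 L) ∧ ∀ x, L - F x = ∫ t in Set.Ioi x, f t := by
  refine ⟨F 0 + ∫ t in Set.Ioi 0, f t, ?_, fun x => ?_⟩
  · exact (tendsto_const_nhds.add
      (intervalIntegral_tendsto_integral_Ioi 0 hf.integrableOn tendsto_id)).congr
      fun y => (h.eq_add 0 y).symm
  · have h1 := h.sub_eq 0 x
    rw [← intervalIntegral.integral_Ioi_sub_Ioi' hf.integrableOn hf.integrableOn] at h1
    linear_combination -h1

namespace IsLinearSolution

variable {P f : ℝ → ℂ}

/-- A bounded solution converges at `+∞` if the coefficient has a finite first moment. With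
`(f - x f')' = -x P f` integrable, `f - x f'` converges; hence `x f'` is bounded, the limit of `f'`
vanishes, and `f'` is at most the tail integral of `P`. -/
theorem exists_tendsto_of_bounded (hP : Integrable P) (hP1 : Integrable fun t : ℝ => t * P t)
    (hf : IsLinearSolution P f) {C : ℝ} (hC : ∀ x, ‖f x‖ ≤ C) :
    ∃ L, Tendsto f atTop (𝓝 L) ∧
      (∀ x, ‖deriv f x‖ ≤ C * ∫ t in Set.Ioi x, ‖P t‖) ∧
      ∀ x, f x - L = ∫ t in Set.Ioi x, ((t : ℂ) - x) * (P t * f t) := by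
  have hPl : LocallyIntegrable P volume := hP.locallyIntegrable
  have hC0 : 0 ≤ C := (norm_nonneg _).trans (hC 0)
  have hPf : Integrable fun t => P t * f t :=
    hP.mul_bdd hf.continuous.aestronglyMeasurable (ae_of_all _ hC)
  have hPf1 : Integrable fun t : ℝ => (t : ℂ) * (P t * f t) := by
    simpa only [mul_assoc] using
      hP1.mul_bdd hf.continuous.aestronglyMeasurable (ae_of_all _ hC)
  obtain ⟨L', hL', hL'x⟩ := (hf.isPrimitive_deriv hPl).exists_tendsto_atTop hPf
  have hid : IsPrimitive (fun t : ℝ => (t : ℂ)) (fun _ => 1) := by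
    refine .of_hasDerivAt continuous_const fun t => ?_
    exact Complex.ofRealCLM.hasDerivAt (x := t)
  have hg : IsPrimitive (fun x : ℝ => f x - x * deriv f x) (fun t : ℝ => -((t : ℂ) * (P t * f t))) :=
    ((hf.isPrimitive hPl).sub (hid.mul (hf.isPrimitive_deriv hPl))).congr fun t => by ring
  obtain ⟨L, hL, hLx⟩ := hg.exists_tendsto_atTop hPf1.neg
  have hL'0 : L' = 0 := by
    have hb : (fun x : ℝ => (x : ℂ) * deriv f x) =O[atTop] (fun _ => (1 : ℝ)) := by
      have h1 : f =O[atTop] (fun _ => (1 : ℝ)) :=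
        IsBigO.of_bound C (Eventually.of_forall fun x => by simpa using hC x)
      refine (h1.sub (hL.isBigO_one ℝ)).congr_left fun x => ?_
      ring
    have h0 : Tendsto (fun x : ℝ => (x : ℂ)⁻¹) atTop (𝓝 0) := by
      have := (Complex.continuous_ofReal.tendsto 0).comp tendsto_inv_atTop_zero
      simpa [Function.comp_def] using this
    have h2 := ((isLittleO_one_iff ℝ).2 h0).mul_isBigO hb
    simp only [mul_one] at h2
    refine tendsto_nhds_unique hL' (((isLittleO_one_iff ℝ).1 h2).congr' ?_)
    filter_upwards [eventually_ne_atTop 0] with x hx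
    rw [inv_mul_cancel_left₀ (by exact_mod_cast hx)]
  subst hL'0
  have hd : ∀ x, deriv f x = -∫ t in Set.Ioi x, P t * f t := fun x => by rw [← hL'x]; ring
  have hrep : ∀ x, f x - L = ∫ t in Set.Ioi x, ((t : ℂ) - x) * (P t * f t) := fun x => by
    simp only [sub_mul]
    rw [integral_sub hPf1.integrableOn (hPf.const_mul _).integrableOn, integral_const_mul]
    have h1 := hLx x
    rw [integral_neg] at h1
    have h2 := hd x
    linear_combination -h1 + x * h2
  refine ⟨L, ?_, fun x => ?_, hrep⟩
  · have htail := tendsto_integral_Ioi_zero (f := fun t : ℝ => ‖(t : ℂ) * (P t * f t)‖)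
      (μ := volume) (tendsto_id (α := ℝ) (x := atTop))
    rw [← tendsto_sub_nhds_zero_iff]
    refine squeeze_zero_norm' ?_ htail
    filter_upwards [eventually_ge_atTop 0] with x hx
    rw [hrep]
    refine norm_integral_le_of_norm_le hPf1.norm.integrableOn ?_
    filter_upwards [ae_restrict_mem measurableSet_Ioi] with t ht
    have ht' : x < t := ht
    rw [norm_mul, norm_mul (t : ℂ)]
    gcongr
    rw [← Complex.ofReal_sub, Complex.norm_real, Complex.norm_real, Real.norm_eq_abs,
      Real.norm_eq_abs, abs_of_nonneg (by linarith), abs_of_nonneg (by linarith)]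
    linarith
  · rw [hd, norm_neg, ← integral_const_mul]
    refine norm_integral_le_of_norm_le (hP.norm.const_mul C).integrableOn (ae_of_all _ fun t => ?_)
    rw [norm_mul, mul_comm]
    gcongr
    exact hC t

/-- A bounded solution with limit zero at `+∞` is trivial: the Volterra equation halves any bound
for it near `+∞`. -/
theorem eq_zero_of_tendsto_zero (hP : Integrable P) (hP1 : Integrable fun t : ℝ => t * P t)
    (hf : IsLinearSolution P f) {C : ℝ} (hC : ∀ x, ‖f x‖ ≤ C) (h0 : Tendsto f atTop (𝓝 0))
    (x : ℝ) : f x = 0 := by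
  obtain ⟨L, hL, -, hrep⟩ := hf.exists_tendsto_of_bounded hP hP1 hC
  obtain rfl := tendsto_nhds_unique hL h0
  have htail := tendsto_integral_Ioi_zero (f := fun t : ℝ => ‖(t : ℂ) * P t‖)
    (μ := volume) (tendsto_id (α := ℝ) (x := atTop))
  obtain ⟨X, hX, hX0⟩ := ((htail.eventually_le_const (show (0 : ℝ) < 1 / 2 by norm_num)).and
    (eventually_ge_atTop 0)).exists
  simp only [id] at hX
  have hhalf : ∀ n : ℕ, ∀ x, X ≤ x → ‖f x‖ ≤ C * (1 / 2) ^ n := by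
    intro n
    induction n with
    | zero => intro x _; simpa using hC x
    | succ n ih =>
      intro x hx
      have h1 : ‖f x‖ ≤ ∫ t in Set.Ioi x, ‖(t : ℂ) * P t‖ * (C * (1 / 2) ^ n) := by
        have h2 := hrep x
        rw [sub_zero] at h2
        rw [h2]
        refine norm_integral_le_of_norm_le (hP1.norm.mul_const _).integrableOn ?_
        filter_upwards [ae_restrict_mem measurableSet_Ioi] with t ht
        have ht' : x < t := ht
        rw [norm_mul, norm_mul (t : ℂ), norm_mul, ← mul_assoc]
        gcongr
        · rw [← Complex.ofReal_sub, Complex.norm_real, Complex.norm_real, Real.norm_eq_abs,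
            Real.norm_eq_abs, abs_of_nonneg (by linarith), abs_of_nonneg (by linarith)]
          linarith
        · exact ih t (by linarith)
      have h3 : ∫ t in Set.Ioi x, ‖(t : ℂ) * P t‖ ≤ 1 / 2 :=
        (setIntegral_mono_set hP1.norm.integrableOn (ae_of_all _ fun t => norm_nonneg _)
          (Set.Ioi_subset_Ioi hx).eventuallyLE).trans hX
      have hC0 : 0 ≤ C * (1 / 2) ^ n := mul_nonneg ((norm_nonneg _).trans (hC 0)) (by positivity)
      rw [integral_mul_const] at h1
      rw [pow_succ]
      nlinarith
  have hz : ∀ x, X ≤ x → f x = 0 := fun x hx => by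
    have h1 : Tendsto (fun n : ℕ => C * (1 / 2) ^ n) atTop (𝓝 (C * 0)) :=
      (tendsto_pow_atTop_nhds_zero_of_lt_one (by norm_num) (by norm_num)).const_mul C
    rw [mul_zero] at h1
    exact norm_le_zero_iff.1 (ge_of_tendsto' h1 fun n => hhalf n x hx)
  have hev : f =ᶠ[𝓝 (X + 1)] fun _ => 0 := by
    filter_upwards [lt_mem_nhds (lt_add_one X)] with x hx using hz x hx.le
  exact hf.eq_zero hP.locallyIntegrable (hz (X + 1) (by linarith))
    (by rw [hev.deriv_eq]; simp) x

/-- Solutions grow at most linearly at `+∞`. -/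
theorem exists_linear_bound_right (hP : Integrable P) (hP1 : Integrable fun t : ℝ => t * P t)
    (hf : IsLinearSolution P f) : ∃ C, ∀ x, 0 ≤ x → ‖f x‖ ≤ C * (1 + x) := by
  have hPl : LocallyIntegrable P volume := hP.locallyIntegrable
  have hI : Integrable fun t : ℝ => ‖P t‖ + ‖(t : ℂ) * P t‖ := hP.norm.add hP1.norm
  have htail := tendsto_integral_Ioi_zero (f := fun t : ℝ => ‖P t‖ + ‖(t : ℂ) * P t‖)
    (μ := volume) (tendsto_id (α := ℝ) (x := atTop))
  obtain ⟨X, hX, hX0⟩ := ((htail.eventually_le_const (show (0 : ℝ) < 1 / 2 by norm_num)).and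
    (eventually_ge_atTop 0)).exists
  simp only [id] at hX
  set K := ‖f X‖ + ‖deriv f X‖ with hK
  have hfar : ∀ R, X ≤ R → ‖f R‖ ≤ 2 * K * (1 + R) := by
    intro R hR
    have hcont : ContinuousOn (fun x => ‖f x‖ / (1 + x)) (Set.Icc X R) := by
      refine hf.continuous.norm.continuousOn.div (by fun_prop) fun x hx => ?_
      linarith [hx.1]
    -- the maximum `S` of `‖f x‖ / (1 + x)` on `[X, R]` satisfies `S ≤ K + S / 2`
    obtain ⟨m, hm, hmax⟩ := isCompact_Icc.exists_isMaxOn (Set.nonempty_Icc.2 hR) hcont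
    set S := ‖f m‖ / (1 + m) with hS
    have hm0 : 0 < 1 + m := by linarith [hm.1]
    have hle : ∀ t ∈ Set.Icc X R, ‖f t‖ ≤ S * (1 + t) := fun t ht => by
      have h1 : ‖f t‖ / (1 + t) ≤ S := hmax ht
      rwa [div_le_iff₀ (by linarith [ht.1])] at h1
    have hS0 : 0 ≤ S := by positivity
    have hint : ‖∫ t in X..m, ((m : ℂ) - t) * (P t * f t)‖ ≤ (1 + m) * (S / 2) := by
      have h1 : ‖∫ t in X..m, ((m : ℂ) - t) * (P t * f t)‖ ≤
          ∫ t in X..m, (‖P t‖ + ‖(t : ℂ) * P t‖) * ((1 + m) * S) := by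
        refine intervalIntegral.norm_integral_le_of_norm_le hm.1 (ae_of_all _ fun t ht => ?_)
          (hI.mul_const _).intervalIntegrable
        have ht0 : 0 ≤ t := hX0.trans ht.1.le
        have h2 := hle t ⟨ht.1.le, ht.2.trans hm.2⟩
        rw [norm_mul, norm_mul, norm_mul, ← Complex.ofReal_sub, Complex.norm_real,
          Complex.norm_real, Real.norm_of_nonneg ht0, Real.norm_of_nonneg (by linarith [ht.2])]
        calc (m - t) * (‖P t‖ * ‖f t‖) ≤ (1 + m) * (‖P t‖ * (S * (1 + t))) := by
              gcongr
              linarith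
          _ = _ := by ring
      have h2 : ∫ t in X..m, (‖P t‖ + ‖(t : ℂ) * P t‖) ≤ 1 / 2 := by
        rw [intervalIntegral.integral_of_le hm.1]
        exact (setIntegral_mono_set hI.integrableOn (ae_of_all _ fun t => by positivity)
          Set.Ioc_subset_Ioi_self.eventuallyLE).trans hX
      rw [intervalIntegral.integral_mul_const] at h1
      have : 0 ≤ (1 + m) * S := by positivity
      nlinarith
    have hrep := hf.eq_add_integral hPl X m
    have h3 : ‖f m‖ ≤ (1 + m) * K + (1 + m) * (S / 2) := by
      rw [hrep]
      refine (norm_add_le _ _).trans (add_le_add ((norm_add_le _ _).trans ?_) hint)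
      rw [norm_mul, ← Complex.ofReal_sub, Complex.norm_real, Real.norm_of_nonneg (by linarith [hm.1]),
        hK]
      nlinarith [norm_nonneg (f X), norm_nonneg (deriv f X), hm.1]
    have h4 : S ≤ K + S / 2 := by
      rw [hS, div_le_iff₀ hm0]; rw [← hS]; linarith
    refine (hle R ⟨hR, le_rfl⟩).trans ?_
    have : 0 ≤ 1 + R := by linarith
    gcongr
    linarith
  obtain ⟨C', hC'⟩ := (isCompact_Icc (a := (0 : ℝ)) (b := X)).exists_bound_of_continuousOn
    hf.continuous.continuousOn
  have hC'0 : 0 ≤ C' := (norm_nonneg _).trans (hC' 0 ⟨le_rfl, hX0⟩)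
  have hK0 : 0 ≤ K := by positivity
  refine ⟨2 * K + C', fun x hx => ?_⟩
  rcases le_total x X with h | h
  · have := hC' x ⟨hx, h⟩
    nlinarith [mul_nonneg hC'0 hx, mul_nonneg hK0 hx]
  · have := hfar x h
    nlinarith [mul_nonneg hC'0 hx]

/-- Solutions grow at most linearly. -/
theorem exists_linear_bound (hP : Integrable P) (hP1 : Integrable fun t : ℝ => t * P t)
    (hf : IsLinearSolution P f) : ∃ C, ∀ x, ‖f x‖ ≤ C * (1 + |x|) := by
  have hP1' : Integrable fun t : ℝ => (t : ℂ) * P (-t) := by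
    simpa using hP1.comp_neg.neg
  obtain ⟨C₁, h₁⟩ := hf.exists_linear_bound_right hP hP1
  obtain ⟨C₂, h₂⟩ := hf.comp_neg.exists_linear_bound_right hP.comp_neg hP1'
  refine ⟨max C₁ C₂, fun x => ?_⟩
  rcases le_total 0 x with h | h
  · rw [abs_of_nonneg h]
    exact (h₁ x h).trans (by gcongr; exact le_max_left _ _)
  · rw [abs_of_nonpos h]
    have := h₂ (-x) (by linarith)
    rw [neg_neg] at this
    exact this.trans (mul_le_mul_of_nonneg_right (le_max_right _ _) (by linarith))

end IsLinearSolution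

/-! ### Bounded solutions and perturbation of a zero-energy resonance -/

namespace IsLinearSolution

variable {P f g : ℝ → ℂ}

theorem conj (hP : ∀ x, star (P x) = P x) (hf : IsLinearSolution P f) :
    IsLinearSolution P (fun x => star (f x)) := by
  refine .of_hasDerivAt (f' := fun x => star (deriv f x)) (fun x => (hf.hasDerivAt x).star)
    fun x y => ?_
  rw [← star_sub, hf.2, intervalIntegral, star_sub, intervalIntegral]
  have key : ∀ s : Set ℝ, star (∫ t in s, P t * f t) = ∫ t in s, P t * star (f t) := fun s => by
    have := integral_conj (𝕜 := ℂ) (μ := volume.restrict s) (f := fun t => P t * f t)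
    rw [starRingEnd_apply] at this
    rw [← this]
    refine integral_congr_ae (ae_of_all _ fun t => ?_)
    simp only [map_mul, starRingEnd_apply, hP]
  rw [key, key]

/-- The limits at both ends of a nontrivial bounded solution exist and do not vanish. -/
theorem exists_limits (hP : Integrable P) (hP1 : Integrable fun t : ℝ => t * P t)
    (hf : IsLinearSolution P f) {C : ℝ} (hC : ∀ x, ‖f x‖ ≤ C) (hne : ∃ x, f x ≠ 0) :
    ∃ cm cp : ℂ, cm ≠ 0 ∧ cp ≠ 0 ∧ Tendsto f atBot (𝓝 cm) ∧ Tendsto f atTop (𝓝 cp) := by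
  have hP1' : Integrable fun t : ℝ => (t : ℂ) * P (-t) := by
    simpa using hP1.comp_neg.neg
  obtain ⟨x, hx⟩ := hne
  obtain ⟨cp, hcp, -⟩ := hf.exists_tendsto_of_bounded hP hP1 hC
  obtain ⟨cm, hcm, -⟩ := hf.comp_neg.exists_tendsto_of_bounded hP.comp_neg hP1' (fun x => hC (-x))
  refine ⟨cm, cp, ?_, ?_, ?_, hcp⟩
  · rintro rfl
    have := hf.comp_neg.eq_zero_of_tendsto_zero hP.comp_neg hP1' (fun x => hC (-x)) hcm (-x)
    rw [neg_neg] at this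
    exact hx this
  · rintro rfl
    exact hx (hf.eq_zero_of_tendsto_zero hP hP1 hC hcp x)
  · simpa [Function.comp_def] using hcm.comp tendsto_neg_atBot_atTop

/-- Bounded solutions are proportional: they are determined by their limits at `+∞`. -/
theorem limit_mul_eq (hP : Integrable P) (hP1 : Integrable fun t : ℝ => t * P t)
    (hf : IsLinearSolution P f) (hg : IsLinearSolution P g) {C D : ℝ} (hC : ∀ x, ‖f x‖ ≤ C)
    (hD : ∀ x, ‖g x‖ ≤ D) {cf cg : ℂ} (hcf : Tendsto f atTop (𝓝 cf)) (hcg : Tendsto g atTop (𝓝 cg))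
    (x : ℝ) : cg * f x = cf * g x := by
  have h := hf.linear_combination hP.locallyIntegrable hg cg (-cf)
  have h0 : Tendsto (fun x => cg * f x + -cf * g x) atTop (𝓝 0) := by
    have := (hcf.const_mul cg).add (hcg.const_mul (-cf))
    rwa [show cg * cf + -cf * cg = 0 by ring] at this
  have hb : ∀ x, ‖cg * f x + -cf * g x‖ ≤ ‖cg‖ * C + ‖-cf‖ * D := fun x => by
    refine (norm_add_le _ _).trans ?_
    rw [norm_mul, norm_mul]
    gcongr
    exacts [hC x, hD x]
  have := h.eq_zero_of_tendsto_zero hP hP1 hb h0 x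
  linear_combination this

/-- Lagrange's identity controls a solution `u` of the equation with coefficient `P - E` on
`[-X, X]` through its Wronskians with a fundamental system `y, z` of the equation with coefficient
`P`, `y` being bounded and `z` of linear growth. If `E X (1 + X)` is small, then `u` is bounded by
its Wronskians at `X`, and these Wronskians are almost constant. -/
theorem wronskian_almost_constant {Q y z u : ℝ → ℂ} (hP : LocallyIntegrable P volume)
    (hQ : LocallyIntegrable Q volume) (hy : IsLinearSolution P y) (hz : IsLinearSolution P z)
    (hu : IsLinearSolution Q u) (hW : ∀ x, wronskian y z x = 1) {Cy Cz X : ℝ} {E : ℂ} (hX : 0 ≤ X)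
    (hCy : ∀ x, ‖y x‖ ≤ Cy) (hCz : ∀ x, ‖z x‖ ≤ Cz * (1 + |x|))
    (hQP : ∀ x ∈ Set.Icc (-X) X, Q x = P x - E) (hE : 4 * Cy * Cz * (‖E‖ * (X * (1 + X))) ≤ 1 / 2)
    {S : ℝ} (hS : S = 2 * (Cy * ‖wronskian u z X‖ + Cz * ((1 + X) * ‖wronskian y u X‖))) :
    (∀ x ∈ Set.Icc (-X) X, ‖u x‖ ≤ S) ∧
      ‖wronskian u z (-X) - wronskian u z X‖ ≤ 2 * Cz * S * (‖E‖ * (X * (1 + X))) ∧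
      ‖wronskian y u (-X) - wronskian y u X‖ ≤ 2 * Cy * S * (‖E‖ * X) := by
  have hCy0 : 0 ≤ Cy := (norm_nonneg _).trans (hCy 0)
  have hCz0 : 0 ≤ Cz := by simpa using (norm_nonneg _).trans (hCz 0)
  have hz' : ∀ x ∈ Set.Icc (-X) X, ‖z x‖ ≤ Cz * (1 + X) := fun x hx =>
    (hCz x).trans (by gcongr; exact abs_le.2 hx)
  have hvar : ∀ {G g v : ℝ → ℂ} {B T : ℝ}, IsPrimitive G g →
      (∀ t ∈ Set.Icc (-X) X, ‖g t‖ = ‖E‖ * (‖u t‖ * ‖v t‖)) →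
      (∀ t ∈ Set.Icc (-X) X, ‖v t‖ ≤ B) → (∀ t ∈ Set.Icc (-X) X, ‖u t‖ ≤ T) →
      ∀ x ∈ Set.Icc (-X) X, ‖G x - G X‖ ≤ ‖E‖ * (T * B) * (2 * X) := by
    intro G g v B T hG hg hB hT x hx
    have hT0 : 0 ≤ T := (norm_nonneg _).trans (hT x hx)
    have hB0 : 0 ≤ B := (norm_nonneg _).trans (hB x hx)
    rw [hG.sub_eq X x]
    refine (intervalIntegral.norm_integral_le_of_norm_le_const (C := ‖E‖ * (T * B))
      fun t ht => ?_).trans ?_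
    · rw [Set.uIoc_of_ge hx.2] at ht
      have ht' : t ∈ Set.Icc (-X) X := ⟨hx.1.trans ht.1.le, ht.2⟩
      rw [hg t ht']
      gcongr
      exacts [hT t ht', hB t ht']
    · have : |x - X| ≤ 2 * X := by rw [abs_le]; constructor <;> linarith [hx.1, hx.2]
      gcongr
  have hα : ∀ {T : ℝ}, (∀ t ∈ Set.Icc (-X) X, ‖u t‖ ≤ T) → ∀ x ∈ Set.Icc (-X) X,
      ‖wronskian u z x - wronskian u z X‖ ≤ ‖E‖ * (T * (Cz * (1 + X))) * (2 * X) :=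
    hvar (hu.isPrimitive_wronskian hQ hP hz)
      (fun t ht => by rw [hQP t ht, sub_sub_cancel, norm_mul, norm_mul]) hz'
  have hβ : ∀ {T : ℝ}, (∀ t ∈ Set.Icc (-X) X, ‖u t‖ ≤ T) → ∀ x ∈ Set.Icc (-X) X,
      ‖wronskian y u x - wronskian y u X‖ ≤ ‖E‖ * (T * Cy) * (2 * X) :=
    hvar (hy.isPrimitive_wronskian hP hQ hu)
      (fun t ht => by
        rw [hQP t ht, sub_sub_cancel_left, norm_mul, norm_mul, norm_neg, mul_comm ‖u t‖])
      (fun t _ => hCy t)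
  have huS : ∀ x ∈ Set.Icc (-X) X, ‖u x‖ ≤ S := by
    -- the maximum `T` of `‖u‖` satisfies `T ≤ S / 2 + T / 2`
    obtain ⟨m, hm, hmax⟩ := isCompact_Icc.exists_isMaxOn
      (Set.nonempty_Icc.2 (show -X ≤ X by linarith)) hu.continuous.norm.continuousOn
    have hT : ∀ t ∈ Set.Icc (-X) X, ‖u t‖ ≤ ‖u m‖ := fun t ht => hmax ht
    have h1 := hα hT m hm
    have h2 := hβ hT m hm
    have h3 : ‖wronskian u z m‖ ≤
        ‖wronskian u z X‖ + ‖E‖ * (‖u m‖ * (Cz * (1 + X))) * (2 * X) := by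
      have := norm_sub_norm_le (wronskian u z m) (wronskian u z X); linarith
    have h4 : ‖wronskian y u m‖ ≤ ‖wronskian y u X‖ + ‖E‖ * (‖u m‖ * Cy) * (2 * X) := by
      have := norm_sub_norm_le (wronskian y u m) (wronskian y u X); linarith
    have h5 : ‖u m‖ ≤ ‖wronskian u z m‖ * Cy + ‖wronskian y u m‖ * (Cz * (1 + X)) := by
      conv_lhs => rw [eq_of_wronskian_eq_one (f := u) (hW m)]
      refine (norm_add_le _ _).trans ?_
      rw [norm_mul, norm_mul]
      gcongr
      exacts [hCy m, hz' m hm]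
    have h6 : ‖u m‖ ≤ S / 2 + ‖u m‖ * (4 * Cy * Cz * (‖E‖ * (X * (1 + X)))) := by
      calc ‖u m‖ ≤ _ := h5
        _ ≤ (‖wronskian u z X‖ + ‖E‖ * (‖u m‖ * (Cz * (1 + X))) * (2 * X)) * Cy +
            (‖wronskian y u X‖ + ‖E‖ * (‖u m‖ * Cy) * (2 * X)) * (Cz * (1 + X)) := by gcongr
        _ = _ := by rw [hS]; ring
    have h7 := mul_le_mul_of_nonneg_left hE (norm_nonneg (u m))
    intro x hx
    have := hT x hx
    linarith
  have hmem : -X ∈ Set.Icc (-X) X := ⟨le_rfl, by linarith⟩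
  exact ⟨huS, (hα huS _ hmem).trans_eq (by ring), (hβ huS _ hmem).trans_eq (by ring)⟩

end IsLinearSolution

/-- Propagation of Cauchy data across the truncated potential in the limit: the value is divided by
`cp / cm` and the derivative, measured in units of `ε`, is multiplied by `cp / cm`. Here `y` is the
half-bound state and `z` a second solution at zero energy; `y'(± ξ) = o(ε)` and `ε ξ → 0`, so that
all errors in the Wronskian of `y` and `u` are `o(ε)`. -/
theorem tendsto_cauchyData {P y z : ℝ → ℂ} (hP : Integrable P)
    (hy : IsLinearSolution P y) (hz : IsLinearSolution P z) (hW : ∀ x, wronskian y z x = 1)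
    {Cy Cz : ℝ} (hCy : ∀ x, ‖y x‖ ≤ Cy) (hCz : ∀ x, ‖z x‖ ≤ Cz * (1 + |x|)) {cm cp : ℂ}
    (hcm0 : cm ≠ 0) (hcp0 : cp ≠ 0) (hcm : Tendsto y atBot (𝓝 cm)) (hcp : Tendsto y atTop (𝓝 cp))
    {ξ : ℝ → ℝ} (hξ : Tendsto ξ (𝓝[>] 0) atTop)
    (hεξ : Tendsto (fun ε => ε * ξ ε) (𝓝[>] 0) (𝓝 0))
    (hyp : Tendsto (fun ε : ℝ => deriv y (ξ ε) / ε) (𝓝[>] 0) (𝓝 0))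
    (hym : Tendsto (fun ε : ℝ => deriv y (-ξ ε) / ε) (𝓝[>] 0) (𝓝 0))
    {k : ℂ} {Q u : ℝ → ℝ → ℂ} (hQ : ∀ᶠ ε in 𝓝[>] (0 : ℝ), LocallyIntegrable (Q ε) volume)
    (hQP : ∀ᶠ ε in 𝓝[>] (0 : ℝ), ∀ x ∈ Set.Icc (-ξ ε) (ξ ε), Q ε x = P x - (ε * k) ^ 2)
    (hu : ∀ᶠ ε in 𝓝[>] (0 : ℝ), IsLinearSolution (Q ε) (u ε)) {d : ℂ}
    (hu0 : Tendsto (fun ε => u ε (ξ ε)) (𝓝[>] 0) (𝓝 1))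
    (hu1 : Tendsto (fun ε : ℝ => deriv (u ε) (ξ ε) / ε) (𝓝[>] 0) (𝓝 d)) :
    Tendsto (fun ε => u ε (-ξ ε)) (𝓝[>] 0) (𝓝 (cm / cp)) ∧
      Tendsto (fun ε : ℝ => deriv (u ε) (-ξ ε) / ε) (𝓝[>] 0) (𝓝 (cp / cm * d)) := by
  have hCy0 : 0 ≤ Cy := (norm_nonneg _).trans (hCy 0)
  have hCz0 : 0 ≤ Cz := by simpa using (norm_nonneg _).trans (hCz 0)
  have hε : Tendsto (fun ε : ℝ => ε) (𝓝[>] 0) (𝓝 0) := tendsto_nhdsWithin_of_tendsto_nhds tendsto_id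
  have hpos : ∀ᶠ ε in 𝓝[>] (0 : ℝ), 0 < ε := eventually_mem_nhdsWithin
  have hξ0 : ∀ᶠ ε in 𝓝[>] (0 : ℝ), 0 < ξ ε := hξ.eventually_gt_atTop 0
  have hε1ξ : Tendsto (fun ε => ε * (1 + ξ ε)) (𝓝[>] 0) (𝓝 0) := by
    have := hε.add hεξ
    rw [add_zero] at this
    exact this.congr fun ε => by ring
  have hyξ := hcp.comp hξ
  have hyξ' := hcm.comp (tendsto_neg_atTop_atBot.comp hξ)
  -- `ε z(± ξ) → 0`
  have hεz : ∀ s : ℝ → ℝ, (∀ᶠ ε in 𝓝[>] (0 : ℝ), |s ε| = ξ ε) →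
      Tendsto (fun ε : ℝ => (ε : ℂ) * z (s ε)) (𝓝[>] 0) (𝓝 0) := fun s hs => by
    have h := hε1ξ.const_mul Cz
    rw [mul_zero] at h
    refine squeeze_zero_norm' ?_ h
    filter_upwards [hpos, hs] with ε h1 h2
    have := hCz (s ε)
    rw [h2] at this
    rw [norm_mul, Complex.norm_real, Real.norm_of_nonneg h1.le]
    calc ε * ‖z (s ε)‖ ≤ ε * (Cz * (1 + ξ ε)) := by gcongr
      _ = _ := by ring
  have hzp := hεz ξ (hξ0.mono fun ε h => abs_of_pos h)
  have hzm := hεz (fun ε => -ξ ε) (hξ0.mono fun ε h => by rw [abs_neg, abs_of_pos h])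
  -- the derivative of `z` at `ξ` from the normalization of the Wronskian
  have hz' : Tendsto (fun ε => deriv z (ξ ε)) (𝓝[>] 0) (𝓝 (1 / cp)) := by
    have h1 : Tendsto (fun ε : ℝ => (1 + deriv y (ξ ε) / ε * (ε * z (ξ ε))) / y (ξ ε)) (𝓝[>] 0)
        (𝓝 ((1 + 0 * 0) / cp)) := (tendsto_const_nhds.add (hyp.mul hzp)).div hyξ hcp0
    rw [zero_mul, add_zero] at h1
    refine h1.congr' ?_
    filter_upwards [hpos, hyξ.eventually_ne hcp0] with ε h2 h3
    have h3' : y (ξ ε) ≠ 0 := h3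
    have h2' : (ε : ℂ) ≠ 0 := by exact_mod_cast h2.ne'
    have h4 := hW (ξ ε)
    rw [wronskian] at h4
    field_simp
    linear_combination -h4
  have hα : Tendsto (fun ε => wronskian (u ε) z (ξ ε)) (𝓝[>] 0) (𝓝 (1 / cp)) := by
    have h1 := (hu0.mul hz').sub (hu1.mul hzp)
    rw [mul_zero, sub_zero, one_mul] at h1
    refine h1.congr' ?_
    filter_upwards [hpos] with ε h2
    have h2' : (ε : ℂ) ≠ 0 := by exact_mod_cast h2.ne'
    rw [wronskian]
    field_simp
  have hβ : Tendsto (fun ε : ℝ => wronskian y (u ε) (ξ ε) / ε) (𝓝[>] 0) (𝓝 (cp * d)) := by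
    have h1 := (hyξ.mul hu1).sub (hyp.mul hu0)
    rw [zero_mul, sub_zero] at h1
    refine h1.congr fun ε => ?_
    simp only [wronskian, Function.comp]
    ring
  have hβ0 : Tendsto (fun ε => (1 + ξ ε) * ‖wronskian y (u ε) (ξ ε)‖) (𝓝[>] 0) (𝓝 0) := by
    have h1 := hε1ξ.mul hβ.norm
    rw [zero_mul] at h1
    refine h1.congr' ?_
    filter_upwards [hpos] with ε h2
    rw [norm_div, Complex.norm_real, Real.norm_of_nonneg h2.le]
    field_simp
  set S : ℝ → ℝ := fun ε =>
    2 * (Cy * ‖wronskian (u ε) z (ξ ε)‖ + Cz * ((1 + ξ ε) * ‖wronskian y (u ε) (ξ ε)‖)) with hS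
  have hSlim : Tendsto S (𝓝[>] 0) (𝓝 (2 * (Cy * ‖1 / cp‖ + Cz * 0))) :=
    ((hα.norm.const_mul Cy).add (hβ0.const_mul Cz)).const_mul 2
  have hsmall : Tendsto (fun ε : ℝ => ‖(ε * k : ℂ) ^ 2‖ * (ξ ε * (1 + ξ ε))) (𝓝[>] 0) (𝓝 0) := by
    have h1 := (hεξ.mul hε1ξ).const_mul (‖k‖ ^ 2)
    rw [mul_zero, mul_zero] at h1
    refine h1.congr' ?_
    filter_upwards [hpos] with ε h2
    rw [norm_pow, norm_mul, Complex.norm_real, Real.norm_of_nonneg h2.le]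
    ring
  have hsmall' : Tendsto (fun ε : ℝ => ‖(ε * k : ℂ) ^ 2‖ * ξ ε / ε) (𝓝[>] 0) (𝓝 0) := by
    have h1 := hεξ.const_mul (‖k‖ ^ 2)
    rw [mul_zero] at h1
    refine h1.congr' ?_
    filter_upwards [hpos] with ε h2
    rw [norm_pow, norm_mul, Complex.norm_real, Real.norm_of_nonneg h2.le]
    field_simp
  have hE : ∀ᶠ ε : ℝ in 𝓝[>] 0,
      4 * Cy * Cz * (‖(ε * k : ℂ) ^ 2‖ * (ξ ε * (1 + ξ ε))) ≤ 1 / 2 := by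
    have h1 := hsmall.const_mul (4 * Cy * Cz)
    rw [mul_zero] at h1
    exact h1.eventually_le_const (by norm_num)
  have hmain : ∀ᶠ ε : ℝ in 𝓝[>] 0, (∀ x ∈ Set.Icc (-ξ ε) (ξ ε), ‖u ε x‖ ≤ S ε) ∧
      ‖wronskian (u ε) z (-ξ ε) - wronskian (u ε) z (ξ ε)‖ ≤
        2 * Cz * S ε * (‖(ε * k : ℂ) ^ 2‖ * (ξ ε * (1 + ξ ε))) ∧
      ‖wronskian y (u ε) (-ξ ε) - wronskian y (u ε) (ξ ε)‖ ≤
        2 * Cy * S ε * (‖(ε * k : ℂ) ^ 2‖ * ξ ε) := by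
    filter_upwards [hξ0, hQ, hQP, hu, hE] with ε h1 h2 h3 h4 h5
    exact IsLinearSolution.wronskian_almost_constant hP.locallyIntegrable h2 hy hz h4 hW h1.le
      hCy hCz h3 h5 rfl
  have hα' : Tendsto (fun ε => wronskian (u ε) z (-ξ ε)) (𝓝[>] 0) (𝓝 (1 / cp)) := by
    have h1 := (hSlim.const_mul (2 * Cz)).mul hsmall
    rw [mul_zero] at h1
    have h2 := (squeeze_zero_norm' (hmain.mono fun ε h => h.2.1) h1).add hα
    rw [zero_add] at h2
    exact h2.congr fun ε => by ring
  have hβ' : Tendsto (fun ε : ℝ => wronskian y (u ε) (-ξ ε) / ε) (𝓝[>] 0) (𝓝 (cp * d)) := by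
    have h1 := (hSlim.const_mul (2 * Cy)).mul hsmall'
    rw [mul_zero] at h1
    have h2 : Tendsto (fun ε : ℝ => (wronskian y (u ε) (-ξ ε) - wronskian y (u ε) (ξ ε)) / ε)
        (𝓝[>] 0) (𝓝 0) := by
      refine squeeze_zero_norm' ?_ h1
      filter_upwards [hmain, hpos] with ε h h0
      rw [norm_div, Complex.norm_real, Real.norm_of_nonneg h0.le, ← mul_div_assoc]
      gcongr
      exact h.2.2
    have h3 := h2.add hβ
    rw [zero_add] at h3
    exact h3.congr fun ε => by ring
  have huval : Tendsto (fun ε => u ε (-ξ ε)) (𝓝[>] 0) (𝓝 (cm / cp)) := by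
    have h1 := (hα'.mul hyξ').add (hβ'.mul hzm)
    rw [mul_zero, add_zero, one_div_mul_eq_div] at h1
    refine h1.congr' ?_
    filter_upwards [hpos] with ε h2
    have h2' : (ε : ℂ) ≠ 0 := by exact_mod_cast h2.ne'
    rw [IsLinearSolution.eq_of_wronskian_eq_one (f := u ε) (hW (-ξ ε)), ← mul_assoc,
      div_mul_cancel₀ _ h2']
    rfl
  refine ⟨huval, ?_⟩
  have h1 := (hβ'.add (hym.mul huval)).div hyξ' hcm0
  rw [zero_mul, add_zero] at h1
  rw [div_mul_eq_mul_div]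
  refine h1.congr' ?_
  filter_upwards [hpos, hyξ'.eventually_ne hcm0] with ε h2 h3
  have h2' : (ε : ℂ) ≠ 0 := by exact_mod_cast h2.ne'
  simp only [Function.comp, Pi.div_apply, wronskian] at h3 ⊢
  field_simp
  ring

/-! ### Free waves, Jost solutions and the point interaction -/

theorem planeWave_zero_right (k : ℂ) : planeWave k 0 = 1 := by simp [planeWave]

theorem planeWave_add (k : ℂ) (x h : ℝ) : planeWave k (x + h) = planeWave k x * planeWave k h := by
  rw [planeWave, planeWave, planeWave, ← Complex.exp_add]; push_cast; ring_nf

theorem planeWave_mul_neg (k : ℂ) (x : ℝ) : planeWave k x * planeWave (-k) x = 1 := by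
  rw [planeWave, planeWave, ← Complex.exp_add]; simp

theorem norm_planeWave (k : ℂ) (x : ℝ) : ‖planeWave k x‖ = Real.exp (-(k.im * x)) := by
  rw [planeWave, Complex.norm_exp]; simp

theorem hasDerivAt_planeWave (k : ℂ) (x : ℝ) :
    HasDerivAt (planeWave k) (Complex.I * k * planeWave k x) x := by
  have h : HasDerivAt (fun x : ℝ => Complex.I * k * (x : ℂ)) (Complex.I * k * 1) x :=
    (Complex.ofRealCLM.hasDerivAt (x := x)).const_mul (Complex.I * k)
  refine h.cexp.congr_deriv ?_
  rw [planeWave]; ring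

theorem continuous_planeWave (k : ℂ) : Continuous (planeWave k) :=
  continuous_iff_continuousAt.2 fun x => (hasDerivAt_planeWave k x).continuousAt

/-- The general solution `a e^{ikx} + b e^{-ikx}` of the free equation. -/
noncomputable def freeWave (k a b : ℂ) (x : ℝ) : ℂ := a * planeWave k x + b * planeWave (-k) x

theorem freeWave_one_zero (k : ℂ) : freeWave k 1 0 = planeWave k := by
  funext x; simp [freeWave]

theorem hasDerivAt_freeWave (k a b : ℂ) (x : ℝ) :
    HasDerivAt (freeWave k a b) (Complex.I * k * freeWave k a (-b) x) x := by
  have := ((hasDerivAt_planeWave k x).const_mul a).add ((hasDerivAt_planeWave (-k) x).const_mul b)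
  refine this.congr_deriv ?_
  simp only [freeWave]; ring

theorem deriv_freeWave (k a b : ℂ) :
    deriv (freeWave k a b) = fun x => Complex.I * k * freeWave k a (-b) x :=
  funext fun x => (hasDerivAt_freeWave k a b x).deriv

theorem continuous_freeWave (k a b : ℂ) : Continuous (freeWave k a b) :=
  (continuous_const.mul (continuous_planeWave k)).add
    (continuous_const.mul (continuous_planeWave (-k)))

theorem continuous_deriv_freeWave (k a b : ℂ) : Continuous (deriv (freeWave k a b)) := by
  rw [deriv_freeWave]; exact continuous_const.mul (continuous_freeWave k a (-b))

theorem hasDerivAt_deriv_freeWave (k a b : ℂ) (x : ℝ) :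
    HasDerivAt (deriv (freeWave k a b)) (-(k ^ 2 * freeWave k a b x)) x := by
  rw [deriv_freeWave]
  refine ((hasDerivAt_freeWave k a (-b) x).const_mul (Complex.I * k)).congr_deriv ?_
  rw [neg_neg]
  linear_combination (k ^ 2 * freeWave k a b x) * Complex.I_sq

/-- The coefficients of a free wave are determined by its Cauchy data at any point. -/
theorem freeWave_coefficients {k : ℂ} (hk : k ≠ 0) (a b : ℂ) (x : ℝ) :
    a = (freeWave k a b x + deriv (freeWave k a b) x / (Complex.I * k)) / 2 * planeWave (-k) x ∧
      b = (freeWave k a b x - deriv (freeWave k a b) x / (Complex.I * k)) / 2 * planeWave k x := by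
  have hIk : Complex.I * k ≠ 0 := mul_ne_zero Complex.I_ne_zero hk
  rw [deriv_freeWave, mul_div_cancel_left₀ _ hIk]
  simp only [freeWave]
  have := planeWave_mul_neg k x
  constructor
  · linear_combination -a * this
  · linear_combination -b * this

/-- Any solution of the free equation on a connected open set is a free wave. -/
theorem exists_eqOn_freeWave {k : ℂ} (hk : k ≠ 0) {s : Set ℝ} (hs : IsOpen s)
    (hs' : IsPreconnected s) {f f' : ℝ → ℂ} (hf : ∀ x ∈ s, HasDerivAt f (f' x) x)
    (hf' : ∀ x ∈ s, HasDerivAt f' (-(k ^ 2 * f x)) x) :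
    ∃ a b, Set.EqOn f (freeWave k a b) s := by
  -- variation of constants for the coefficient of `e^{ilx}`, where `l = ± k`
  have key : ∀ l : ℂ, l ^ 2 = k ^ 2 →
      ∃ a, ∀ x ∈ s, (Complex.I * l * f x + f' x) * planeWave (-l) x = a := by
    intro l hl
    have hd : ∀ x ∈ s,
        HasDerivAt (fun x => (Complex.I * l * f x + f' x) * planeWave (-l) x) 0 x := fun x hx => by
      refine ((((hf x hx).const_mul (Complex.I * l)).add (hf' x hx)).mul
        (hasDerivAt_planeWave (-l) x)).congr_deriv ?_
      simp only [Pi.add_apply]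
      linear_combination (f x * planeWave (-l) x) * hl -
        (l ^ 2 * f x * planeWave (-l) x) * Complex.I_sq
    exact hs.exists_is_const_of_deriv_eq_zero hs'
      (fun x hx => (hd x hx).differentiableAt.differentiableWithinAt) fun x hx => (hd x hx).deriv
  obtain ⟨a, ha⟩ := key k rfl
  obtain ⟨b, hb⟩ := key (-k) (neg_sq k)
  refine ⟨a / (2 * Complex.I * k), -b / (2 * Complex.I * k), fun x hx => ?_⟩
  have hI := Complex.I_ne_zero
  have h1 := planeWave_mul_neg k x
  have h2 := ha x hx
  have h3 := hb x hx
  rw [neg_neg] at h3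
  rw [freeWave]
  field_simp
  linear_combination -(2 * Complex.I * k * f x) * h1 + planeWave k x * h2 - planeWave (-k) x * h3

/-- A free wave that is negligible with respect to the smaller of the two exponentials vanishes. -/
theorem freeWave_coefficients_eq_zero {k : ℂ} (hk : k ≠ 0) {a b : ℂ}
    (h : freeWave k a b =o[atTop] (fun x : ℝ => Real.exp (-(|k.im| * x)))) : a = 0 ∧ b = 0 := by
  have key : ∀ (k a b : ℂ), k ≠ 0 →
      freeWave k a b =o[atTop] (fun x : ℝ => Real.exp (-(|k.im| * x))) → a = 0 := by
    intro k a b hk h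
    -- a translation that separates the two exponentials
    obtain ⟨s, hs⟩ : ∃ s, planeWave k s ≠ planeWave (-k) s := by
      by_contra! hcon
      have h1 := hasDerivAt_planeWave k 0
      rw [funext hcon] at h1
      have h2 := h1.unique (hasDerivAt_planeWave (-k) 0)
      rw [planeWave_zero_right] at h2
      have h3 : Complex.I * k * 2 = 0 := by linear_combination h2
      simp [Complex.I_ne_zero, hk] at h3
    have hshift : (fun x => freeWave k a b (x + s)) =o[atTop]
        (fun x : ℝ => Real.exp (-(|k.im| * x))) := by
      have h1 := h.comp_tendsto (tendsto_atTop_add_const_right atTop s tendsto_id)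
      have e : (fun x : ℝ => Real.exp (-(|k.im| * x))) ∘ (fun x => id x + s) =
          fun x : ℝ => Real.exp (-(|k.im| * s)) * Real.exp (-(|k.im| * x)) := by
        funext x
        rw [← Real.exp_add]
        simp only [Function.comp, id]
        ring_nf
      rw [e] at h1
      exact h1.trans_isBigO (isBigO_const_mul_self _ _ _)
    have h2 := hshift.sub (h.const_mul_left (planeWave (-k) s))
    have h3 : (fun x => a * (planeWave k s - planeWave (-k) s) * planeWave k x) =o[atTop]
        (planeWave k) := by
      refine (h2.congr_left fun x => ?_).trans_isBigO (IsBigO.of_bound 1 ?_)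
      · simp only [freeWave, planeWave_add]; ring
      · filter_upwards [eventually_ge_atTop 0] with x hx
        rw [one_mul, norm_planeWave, Real.norm_of_nonneg (Real.exp_pos _).le, Real.exp_le_exp]
        have := mul_le_mul_of_nonneg_right (le_abs_self k.im) hx
        linarith
    by_contra ha
    have h4 := (isLittleO_const_mul_left_iff (mul_ne_zero ha (sub_ne_zero.2 hs))).1 h3
    refine isLittleO_irrefl (Frequently.of_forall fun x => ?_) h4
    exact Complex.exp_ne_zero _
  refine ⟨key k a b hk h, key (-k) b a (neg_ne_zero.2 hk) ?_⟩
  rw [Complex.neg_im, abs_neg]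
  refine h.congr_left fun x => ?_
  simp only [freeWave, neg_neg]; ring

/-- A solution of the free equation on `(c, ∞)` with the asymptotics `e^{ikx}` is `e^{ikx}`. -/
theorem AsympRight.eqOn_planeWave {k : ℂ} (hk : k ≠ 0) {f f' : ℝ → ℂ} {c : ℝ}
    (hf : ∀ x ∈ Set.Ioi c, HasDerivAt f (f' x) x)
    (hf' : ∀ x ∈ Set.Ioi c, HasDerivAt f' (-(k ^ 2 * f x)) x) (h : AsympRight k f) :
    Set.EqOn f (planeWave k) (Set.Ioi c) := by
  obtain ⟨a, b, hab⟩ := exists_eqOn_freeWave hk isOpen_Ioi isPreconnected_Ioi hf hf'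
  have h1 : freeWave k (a - 1) b =o[atTop] (fun x : ℝ => Real.exp (-(|k.im| * x))) := by
    refine IsLittleO.congr' h ?_ EventuallyEq.rfl
    filter_upwards [eventually_gt_atTop c] with x hx
    rw [hab hx, freeWave, freeWave]; ring
  obtain ⟨h2, rfl⟩ := freeWave_coefficients_eq_zero hk h1
  rw [sub_eq_zero] at h2
  rwa [h2, freeWave_one_zero] at hab

theorem AsympRight.of_eqOn {k : ℂ} {f : ℝ → ℂ} {c : ℝ}
    (h : Set.EqOn f (planeWave k) (Set.Ioi c)) : AsympRight k f := by
  refine IsLittleO.congr' (isLittleO_zero _ _) ?_ EventuallyEq.rfl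
  filter_upwards [eventually_gt_atTop c] with x hx
  rw [h hx, sub_self]

namespace IsLinearSolution

variable {P f : ℝ → ℂ} {k : ℂ}

/-- Where the potential vanishes, a solution is twice differentiable. -/
theorem hasDerivAt_deriv (hf : IsLinearSolution P f) {s : Set ℝ} (hs : IsOpen s)
    [hs' : s.OrdConnected] (hP : ∀ x ∈ s, P x = -k ^ 2) {x : ℝ} (hx : x ∈ s) :
    HasDerivAt (deriv f) (-(k ^ 2 * f x)) x := by
  have hc : Continuous fun t => -(k ^ 2 * f t) := (continuous_const.mul hf.continuous).neg
  have h1 : HasDerivAt (fun v => deriv f x + ∫ t in x..v, -(k ^ 2 * f t)) (-(k ^ 2 * f x)) x :=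
    (intervalIntegral.integral_hasDerivAt_right (hc.intervalIntegrable _ _)
      (hc.stronglyMeasurableAtFilter _ _) hc.continuousAt).const_add _
  refine h1.congr_of_eventuallyEq ?_
  filter_upwards [hs.mem_nhds hx] with v hv
  rw [← sub_eq_iff_eq_add', hf.2 x v]
  refine intervalIntegral.integral_congr fun t ht => ?_
  simp only [hP t (hs'.uIcc_subset hx hv ht)]
  ring

theorem exists_eqOn_freeWave (hk : k ≠ 0) (hf : IsLinearSolution P f) {s : Set ℝ} (hs : IsOpen s)
    [hs' : s.OrdConnected] (hP : ∀ x ∈ s, P x = -k ^ 2) : ∃ a b, Set.EqOn f (freeWave k a b) s :=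
  _root_.exists_eqOn_freeWave hk hs hs'.isPreconnected (fun x _ => hf.hasDerivAt x)
    fun _ hx => hf.hasDerivAt_deriv hs hP hx

/-- The Cauchy data of a solution that is a free wave on one side of a point. -/
theorem cauchyData_eq (hPl : LocallyIntegrable P volume) (hf : IsLinearSolution P f) {a b : ℂ}
    {s : Set ℝ} (hs : IsOpen s) (h : Set.EqOn f (freeWave k a b) s) {c : ℝ} (hc : c ∈ closure s) :
    f c = freeWave k a b c ∧ deriv f c = deriv (freeWave k a b) c :=
  ⟨h.closure hf.continuous (continuous_freeWave k a b) hc,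
    (h.deriv hs).closure (hf.continuous_deriv hPl) (continuous_deriv_freeWave k a b) hc⟩

/-- For a perturbation supported in `[-c, c]`, the right Jost solution is the solution with the
Cauchy data of `e^{ikx}` at `c`. -/
theorem asympRight_iff (hk : k ≠ 0) (hPl : LocallyIntegrable P volume) (hf : IsLinearSolution P f)
    {c : ℝ} (hP : ∀ x ∈ Set.Ioi c, P x = -k ^ 2) :
    AsympRight k f ↔ f c = planeWave k c ∧ deriv f c = deriv (planeWave k) c := by
  have hcl : c ∈ closure (Set.Ioi c) := by simp
  refine ⟨fun h => ?_, fun ⟨h0, h1⟩ => ?_⟩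
  · have h1 : Set.EqOn f (freeWave k 1 0) (Set.Ioi c) := by
      rw [freeWave_one_zero]
      exact h.eqOn_planeWave hk (fun x _ => hf.hasDerivAt x)
        fun _ hx => hf.hasDerivAt_deriv isOpen_Ioi hP hx
    have := hf.cauchyData_eq hPl isOpen_Ioi h1 hcl
    rwa [freeWave_one_zero] at this
  · obtain ⟨a, b, hab⟩ := hf.exists_eqOn_freeWave hk isOpen_Ioi hP
    obtain ⟨h2, h3⟩ := hf.cauchyData_eq hPl isOpen_Ioi hab hcl
    obtain ⟨h4, h5⟩ := freeWave_coefficients hk a b c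
    obtain ⟨h6, h7⟩ := freeWave_coefficients hk 1 0 c
    rw [← h2, ← h3, h0, h1] at h4 h5
    rw [freeWave_one_zero] at h6 h7
    rw [← h6] at h4
    rw [← h7] at h5
    rw [h4, h5, freeWave_one_zero] at hab
    exact .of_eqOn hab

/-- Existence and uniqueness of the scattering coefficients of a compactly supported
perturbation. -/
theorem existsUnique_jostCoefficients (hk : k ≠ 0) (hPl : LocallyIntegrable P volume) {c : ℝ}
    (hPr : ∀ x ∈ Set.Ioi c, P x = -k ^ 2) (hPm : ∀ x ∈ Set.Iio (-c), P x = -k ^ 2) :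
    ∃! p : ℂ × ℂ, HasJostCoefficients (IsLinearSolution P) k c p.1 p.2 := by
  obtain ⟨f, hf, hf0, hf1⟩ := exists_of_initial hPl c (planeWave k c) (deriv (planeWave k) c)
  obtain ⟨a, b, hab⟩ := hf.exists_eqOn_freeWave hk isOpen_Iio hPm
  refine ⟨(a, b), ⟨f, hf, (hf.asympRight_iff hk hPl hPr).2 ⟨hf0, hf1⟩, fun x hx => hab hx⟩, ?_⟩
  rintro ⟨a', b'⟩ ⟨g, hg, hga, hgab⟩
  obtain ⟨hg0, hg1⟩ := (hg.asympRight_iff hk hPl hPr).1 hga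
  obtain rfl := hf.eq_of_initial hPl hg (hf0.trans hg0.symm) (hf1.trans hg1.symm)
  have hcl : -c ∈ closure (Set.Iio (-c)) := by simp
  obtain ⟨h2, h3⟩ := hf.cauchyData_eq hPl isOpen_Iio hab hcl
  have hab' : Set.EqOn f (freeWave k a' b') (Set.Iio (-c)) := fun x hx => hgab x hx
  obtain ⟨h2', h3'⟩ := hf.cauchyData_eq hPl isOpen_Iio hab' hcl
  obtain ⟨h4, h5⟩ := freeWave_coefficients hk a b (-c)
  obtain ⟨h4', h5'⟩ := freeWave_coefficients hk a' b' (-c)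
  rw [← h2, ← h3] at h4 h5
  rw [← h2', ← h3', ← h4] at h4'
  rw [← h2', ← h3', ← h5] at h5'
  rw [h4', h5']

end IsLinearSolution

/-- The right Jost solution of the point interaction `S(θ)` in terms of its coefficients. -/
theorem IsPointInteractionSolution.jostCoefficients_iff {θ : ℝ} (hθ : θ ≠ 0) {k : ℂ} (hk : k ≠ 0)
    {a b : ℂ} : HasJostCoefficients (IsPointInteractionSolution θ k) k 0 a b ↔
      a = (1 + (θ : ℂ) ^ 2) / (2 * θ) ∧ b = (1 - (θ : ℂ) ^ 2) / (2 * θ) := by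
  have hθ' : (θ : ℂ) ≠ 0 := by exact_mod_cast hθ
  have hIk : Complex.I * k ≠ 0 := mul_ne_zero Complex.I_ne_zero hk
  have hw : ∀ a b : ℂ, freeWave k a b 0 = a + b := fun a b => by
    simp [freeWave, planeWave_zero_right]
  have lim : ∀ {f : ℝ → ℂ} {a b : ℂ} {s : Set ℝ}, IsOpen s → Set.EqOn f (freeWave k a b) s →
      Tendsto f (𝓝[s] 0) (𝓝 (a + b)) ∧
        Tendsto (deriv f) (𝓝[s] 0) (𝓝 (Complex.I * k * (a - b))) := by
    intro f a b s hs h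
    constructor
    · rw [← hw]
      exact ((continuous_freeWave k a b).continuousWithinAt.tendsto).congr'
        (eventually_nhdsWithin_of_forall fun x hx => (h hx).symm)
    · rw [sub_eq_add_neg, ← hw]
      have := (continuous_deriv_freeWave k a b).continuousWithinAt (s := s) (x := 0)
      rw [ContinuousWithinAt, deriv_freeWave] at this
      refine this.congr' (eventually_nhdsWithin_of_forall fun x hx => ?_)
      rw [h.deriv hs hx, deriv_freeWave]
  constructor
  · rintro ⟨f, ⟨hf, yp, ym, dp, dm, hyp, hym, hdp, hdm, hy, hd⟩, hfa, hfab⟩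
    have hr : Set.EqOn f (freeWave k 1 0) (Set.Ioi 0) := by
      rw [freeWave_one_zero]
      exact hfa.eqOn_planeWave hk (fun x hx => (hf x (ne_of_gt hx)).1.hasDerivAt)
        fun x hx => (hf x (ne_of_gt hx)).2
    have hl : Set.EqOn f (freeWave k a b) (Set.Iio 0) := fun x hx => hfab x (by simpa using hx)
    obtain ⟨h1, h2⟩ := lim isOpen_Ioi hr
    obtain ⟨h3, h4⟩ := lim isOpen_Iio hl
    rw [tendsto_nhds_unique hyp h1, tendsto_nhds_unique hym h3] at hy
    rw [tendsto_nhds_unique hdp h2, tendsto_nhds_unique hdm h4] at hd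
    have hd' : (θ : ℂ) = a - b := mul_left_cancel₀ hIk (by linear_combination hd)
    constructor
    · field_simp
      linear_combination -hy - θ * hd'
    · field_simp
      linear_combination -hy + θ * hd'
  · rintro ⟨ha, hb⟩
    set f : ℝ → ℂ := fun x => if 0 < x then planeWave k x else freeWave k a b x with hf
    have hr : Set.EqOn f (freeWave k 1 0) (Set.Ioi 0) := fun x hx => by
      rw [freeWave_one_zero]; exact if_pos hx
    have hl : Set.EqOn f (freeWave k a b) (Set.Iio 0) := fun x hx =>
      if_neg (not_lt.2 (le_of_lt hx))
    have hsol : ∀ {a b : ℂ} {s : Set ℝ}, IsOpen s → Set.EqOn f (freeWave k a b) s → ∀ x ∈ s,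
        DifferentiableAt ℝ f x ∧ HasDerivAt (deriv f) (-(k ^ 2 * f x)) x := by
      intro a b s hs h x hx
      have he : f =ᶠ[𝓝 x] freeWave k a b := Filter.eventuallyEq_of_mem (hs.mem_nhds hx) h
      refine ⟨((hasDerivAt_freeWave k a b x).congr_of_eventuallyEq he).differentiableAt, ?_⟩
      rw [h hx]
      exact (hasDerivAt_deriv_freeWave k a b x).congr_of_eventuallyEq he.deriv
    obtain ⟨h1, h2⟩ := lim isOpen_Ioi hr
    obtain ⟨h3, h4⟩ := lim isOpen_Iio hl
    refine ⟨f, ⟨fun x hx => ?_, _, _, _, _, h1, h3, h2, h4, ?_, ?_⟩, ?_, fun x hx => hl ?_⟩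
    · rcases lt_or_gt_of_ne hx with h | h
      exacts [hsol isOpen_Iio hl x h, hsol isOpen_Ioi hr x h]
    · rw [ha, hb]; field_simp; ring
    · rw [ha, hb]; field_simp; ring
    · rw [freeWave_one_zero] at hr
      exact .of_eqOn hr
    · simpa using hx

/-! ### Potentials of the Faddeev-Marchenko class and truncation -/

namespace FaddeevMarchenko

variable {V : ℝ → ℝ}

theorem integrable (hV : FaddeevMarchenko V) : Integrable V := by
  refine hV.2.mono' hV.1 (ae_of_all _ fun t => ?_)
  rw [Real.norm_eq_abs]
  nlinarith [abs_nonneg t, abs_nonneg (V t), mul_nonneg (abs_nonneg t) (abs_nonneg (V t))]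

theorem integrable_coefficient (hV : FaddeevMarchenko V) :
    Integrable fun t => (V t : ℂ) - (0 : ℂ) ^ 2 := by
  simpa using hV.integrable.ofReal (𝕜 := ℂ)

theorem integrable_mul_coefficient (hV : FaddeevMarchenko V) :
    Integrable fun t : ℝ => (t : ℂ) * ((V t : ℂ) - (0 : ℂ) ^ 2) := by
  refine hV.2.mono' (Complex.continuous_ofReal.aestronglyMeasurable.mul
    hV.integrable_coefficient.aestronglyMeasurable) (ae_of_all _ fun t => ?_)
  simp only [ne_eq, OfNat.ofNat_ne_zero, not_false_eq_true, zero_pow, sub_zero, norm_mul,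
    Complex.norm_real, Real.norm_eq_abs]
  nlinarith [abs_nonneg (V t)]

end FaddeevMarchenko

namespace IsCutoffWeight

variable {V ρ : ℝ → ℝ}

theorem comp_neg (h : IsCutoffWeight V ρ) : IsCutoffWeight (fun x => V (-x)) ρ where
  even := h.even
  continuous := h.continuous
  pos := h.pos
  strictMonoOn := h.strictMonoOn
  tendsto_atTop := h.tendsto_atTop
  tendsto_atBot := h.tendsto_atBot
  integrable := by simpa [h.even] using h.integrable.comp_neg

theorem tendsto_cutoff (h : IsCutoffWeight V ρ) {ξ : ℝ → ℝ}
    (hξ : ∀ᶠ ε in 𝓝[>] (0 : ℝ), 0 < ξ ε ∧ ρ (ξ ε) = 1 / ε) : Tendsto ξ (𝓝[>] 0) atTop := by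
  rw [Filter.tendsto_atTop]
  intro R
  have hR : (0 : ℝ) < max R 1 := lt_max_of_lt_right one_pos
  filter_upwards [hξ, tendsto_inv_nhdsGT_zero.eventually_gt_atTop (ρ (max R 1))] with ε h1 h2
  rw [← one_div, ← h1.2, h.strictMonoOn.lt_iff_lt hR h1.1] at h2
  exact (le_max_left _ _).trans h2.le

theorem tendsto_mul_cutoff (h : IsCutoffWeight V ρ) {ξ : ℝ → ℝ}
    (hξ : ∀ᶠ ε in 𝓝[>] (0 : ℝ), 0 < ξ ε ∧ ρ (ξ ε) = 1 / ε) :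
    Tendsto (fun ε => ε * ξ ε) (𝓝[>] 0) (𝓝 0) := by
  have h1 := tendsto_inv_atTop_zero.comp (h.tendsto_atTop.comp (h.tendsto_cutoff hξ))
  refine h1.congr' ?_
  filter_upwards [hξ] with ε h2
  simp [h2.2, abs_of_pos h2.1, mul_comm]

/-- Beyond the cut-off the potential has mass `o(ε)`, because the weight exceeds `1 / ε` there. -/
theorem tendsto_tail_div (h : IsCutoffWeight V ρ) (hV : Integrable V) {ξ : ℝ → ℝ}
    (hξ : ∀ᶠ ε in 𝓝[>] (0 : ℝ), 0 < ξ ε ∧ ρ (ξ ε) = 1 / ε) :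
    Tendsto (fun ε => (∫ t in Set.Ioi (ξ ε), |V t|) / ε) (𝓝[>] 0) (𝓝 0) := by
  have htail := tendsto_integral_Ioi_zero (f := fun t => ρ t * |V t|) (μ := volume)
    (h.tendsto_cutoff hξ)
  have hpos : ∀ᶠ ε in 𝓝[>] (0 : ℝ), 0 < ε := eventually_mem_nhdsWithin
  refine squeeze_zero' ?_ ?_ htail
  · filter_upwards [hpos] with ε h0
    exact div_nonneg (integral_nonneg fun t => abs_nonneg _) h0.le
  · filter_upwards [hpos, hξ] with ε h0 h1
    rw [← integral_div]
    refine setIntegral_mono_on (hV.abs.div_const ε).integrableOn h.integrable.integrableOn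
      measurableSet_Ioi fun t ht => ?_
    have h2 : ρ (ξ ε) ≤ ρ t := (h.strictMonoOn h1.1 (h1.1.trans ht) ht).le
    rw [h1.2] at h2
    rw [div_eq_mul_one_div, mul_comm]
    gcongr

end IsCutoffWeight

/-- The derivative of a half-bound state at the cut-off points is `o(ε)`. -/
theorem IsCutoffWeight.tendsto_deriv_div {V ρ : ℝ → ℝ} (h : IsCutoffWeight V ρ)
    (hV : Integrable V) {y : ℝ → ℂ} {C : ℝ}
    (hy : ∀ x, ‖deriv y x‖ ≤ C * ∫ t in Set.Ioi x, ‖(V t : ℂ) - (0 : ℂ) ^ 2‖) {ξ : ℝ → ℝ}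
    (hξ : ∀ᶠ ε in 𝓝[>] (0 : ℝ), 0 < ξ ε ∧ ρ (ξ ε) = 1 / ε) :
    Tendsto (fun ε : ℝ => deriv y (ξ ε) / ε) (𝓝[>] 0) (𝓝 0) := by
  have h1 := (h.tendsto_tail_div hV hξ).const_mul C
  rw [mul_zero] at h1
  refine squeeze_zero_norm' ?_ h1
  filter_upwards [eventually_mem_nhdsWithin] with ε (h0 : 0 < ε)
  rw [norm_div, Complex.norm_real, Real.norm_of_nonneg h0.le, ← mul_div_assoc]
  gcongr
  simpa using hy (ξ ε)

/-- The ratio of the limits of half-bound states is a well-defined nonzero real number. It is real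
since complex conjugation maps half-bound states to half-bound states. -/
theorem exists_halfBoundState_ratio {V : ℝ → ℝ} (hV : FaddeevMarchenko V) {y : ℝ → ℂ}
    (hy : IsHalfBoundState V y) :
    ∃ (θ : ℝ) (cm cp : ℂ), θ ≠ 0 ∧ cm ≠ 0 ∧ cp ≠ 0 ∧ Tendsto y atBot (𝓝 cm) ∧
      Tendsto y atTop (𝓝 cp) ∧ (θ : ℂ) = cp / cm ∧
      ∀ g : ℝ → ℂ, IsHalfBoundState V g →
        ∃ dm dp : ℂ, dm ≠ 0 ∧ dp ≠ 0 ∧ Tendsto g atBot (𝓝 dm) ∧ Tendsto g atTop (𝓝 dp) ∧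
          (θ : ℂ) = dp / dm := by
  have hP := hV.integrable_coefficient
  have hP1 := hV.integrable_mul_coefficient
  obtain ⟨hys, hy0, C, hC⟩ := hy
  have hys : IsLinearSolution (fun t => (V t : ℂ) - (0 : ℂ) ^ 2) y := hys
  obtain ⟨cm, cp, hcm0, hcp0, hcm, hcp⟩ := hys.exists_limits hP hP1 hC hy0
  have hstar := hys.conj fun x => by simp
  have hratio : ∀ {g : ℝ → ℂ} {D : ℝ} {dm dp : ℂ},
      IsLinearSolution (fun t => (V t : ℂ) - (0 : ℂ) ^ 2) g → (∀ x, ‖g x‖ ≤ D) → dm ≠ 0 →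
      Tendsto g atBot (𝓝 dm) → Tendsto g atTop (𝓝 dp) → cp / cm = dp / dm := by
    intro g D dm dp hg hD hdm0 hdm hdp
    have h1 := hys.limit_mul_eq hP hP1 hg hC hD hcp hdp
    have h2 := tendsto_nhds_unique (hcm.const_mul dp) ((hdm.const_mul cp).congr fun x => (h1 x).symm)
    rw [div_eq_div_iff hcm0 hdm0, h2]
  have hreal : starRingEnd ℂ (cp / cm) = cp / cm := by
    rw [map_div₀]
    exact (hratio hstar (fun x => by rw [norm_star]; exact hC x) (by simpa using hcm0)
      ((continuous_star.tendsto cm).comp hcm) ((continuous_star.tendsto cp).comp hcp)).symm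
  obtain ⟨θ, hθ⟩ := Complex.conj_eq_iff_real.1 hreal
  refine ⟨θ, cm, cp, ?_, hcm0, hcp0, hcm, hcp, hθ.symm, fun g ⟨hg, hg0, D, hD⟩ => ?_⟩
  · rintro rfl
    exact div_ne_zero hcp0 hcm0 (by simpa using hθ)
  · have hg : IsLinearSolution (fun t => (V t : ℂ) - (0 : ℂ) ^ 2) g := hg
    obtain ⟨dm, dp, hdm0, hdp0, hdm, hdp⟩ := hg.exists_limits hP hP1 hD hg0
    exact ⟨dm, dp, hdm0, hdp0, hdm, hdp, hθ.symm.trans (hratio hg hD hdm0 hdm hdp)⟩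

section Truncated

variable {V : ℝ → ℝ} {ε c : ℝ} {k : ℂ}

theorem locallyIntegrable_truncated (hV : Integrable V) (ε c : ℝ) (k : ℂ) :
    LocallyIntegrable (fun x => (truncatedPotential V ε c x : ℂ) - k ^ 2) volume := by
  have h1 : Integrable (truncatedPotential V ε c) := by
    rcases eq_or_ne ε 0 with rfl | hε
    · simp [truncatedPotential]
    · exact ((hV.comp_div hε).const_mul _).indicator measurableSet_Icc
  exact (h1.ofReal (𝕜 := ℂ)).locallyIntegrable.sub continuous_const.locallyIntegrable

theorem truncatedPotential_of_notMem {x : ℝ} (hx : x ∉ Set.Icc (-c) c) :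
    (truncatedPotential V ε c x : ℂ) - k ^ 2 = -k ^ 2 := by
  simp [truncatedPotential, Set.indicator_of_notMem hx]

theorem truncatedPotential_right (x : ℝ) (hx : x ∈ Set.Ioi c) :
    (truncatedPotential V ε c x : ℂ) - k ^ 2 = -k ^ 2 :=
  truncatedPotential_of_notMem fun h => absurd h.2 (not_le.2 hx)

theorem truncatedPotential_left (x : ℝ) (hx : x ∈ Set.Iio (-c)) :
    (truncatedPotential V ε c x : ℂ) - k ^ 2 = -k ^ 2 :=
  truncatedPotential_of_notMem fun h => absurd h.1 (not_le.2 hx)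

/-- In the variable `x / ε` the truncated potential is `V` itself. -/
theorem sq_mul_truncatedPotential (hε : 0 < ε) {ξ s : ℝ} (hs : s ∈ Set.Icc (-ξ) ξ) :
    (ε : ℂ) ^ 2 * ((truncatedPotential V ε (ε * ξ) (ε * s) : ℂ) - k ^ 2) =
      V s - (0 : ℂ) ^ 2 - (ε * k) ^ 2 := by
  have hmem : ε * s ∈ Set.Icc (-(ε * ξ)) (ε * ξ) :=
    ⟨by nlinarith [hs.1], by nlinarith [hs.2]⟩
  have hε' : (ε : ℂ) ≠ 0 := by exact_mod_cast hε.ne'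
  rw [truncatedPotential, Set.indicator_of_mem hmem, mul_div_cancel_left₀ _ hε.ne']
  push_cast
  field_simp
  ring

theorem locallyIntegrable_rescaled {P : ℝ → ℂ} (hP : LocallyIntegrable P volume) (hε : ε ≠ 0) :
    LocallyIntegrable (fun s : ℝ => (ε : ℂ) ^ 2 * P (ε * s)) volume := by
  suffices h : LocallyIntegrable (fun s => P (ε * s)) volume from
    h.continuous_mul continuous_const
  rw [locallyIntegrable_iff]
  intro K hK
  have h1 : IntegrableOn P ((fun s => ε * s) '' K) :=
    hP.integrableOn_isCompact (hK.image (continuous_const_mul ε))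
  rw [← integrable_indicator_iff (hK.image (continuous_const_mul ε)).measurableSet] at h1
  rw [← integrable_indicator_iff hK.measurableSet]
  refine (h1.comp_mul_left' hε).congr (ae_of_all _ fun s => ?_)
  have hm : ε * s ∈ (fun s => ε * s) '' K ↔ s ∈ K := (mul_right_injective₀ hε).mem_set_image
  beta_reduce
  by_cases hs : s ∈ K
  · rw [Set.indicator_of_mem (hm.2 hs), Set.indicator_of_mem hs]
  · rw [Set.indicator_of_notMem (mt hm.1 hs), Set.indicator_of_notMem hs]

end Truncated

/-- The scattering coefficients of the truncated operators have the limits prescribed by the ratio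
of a half-bound state. -/
theorem tendsto_jostCoefficients {V ρ : ℝ → ℝ} (hV : FaddeevMarchenko V) {y : ℝ → ℂ}
    (hy : IsHalfBoundState V y) {cm cp : ℂ} (hcm0 : cm ≠ 0) (hcp0 : cp ≠ 0)
    (hcm : Tendsto y atBot (𝓝 cm)) (hcp : Tendsto y atTop (𝓝 cp)) (hρ : IsCutoffWeight V ρ)
    {ξ : ℝ → ℝ} (hξ : ∀ᶠ ε in 𝓝[>] (0 : ℝ), 0 < ξ ε ∧ ρ (ξ ε) = 1 / ε) {k : ℂ} (hk : k ≠ 0)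
    {a b : ℝ → ℂ} (hab : ∀ᶠ ε in 𝓝[>] (0 : ℝ), HasJostCoefficients
      (IsSchrodingerSolution (truncatedPotential V ε (ε * ξ ε)) k) k (ε * ξ ε) (a ε) (b ε)) :
    Tendsto a (𝓝[>] 0) (𝓝 ((cm / cp + cp / cm) / 2)) ∧
      Tendsto b (𝓝[>] 0) (𝓝 ((cm / cp - cp / cm) / 2)) := by
  have hP := hV.integrable_coefficient
  have hP1 := hV.integrable_mul_coefficient
  have hIk : Complex.I * k ≠ 0 := mul_ne_zero Complex.I_ne_zero hk
  obtain ⟨hys, ⟨x₀, hx₀⟩, Cy, hCy⟩ := hy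
  have hys : IsLinearSolution (fun t => (V t : ℂ) - (0 : ℂ) ^ 2) y := hys
  obtain ⟨z, hz, hz0, hz1⟩ :=
    IsLinearSolution.exists_of_initial hP.locallyIntegrable x₀ 0 (y x₀)⁻¹
  have hW : ∀ x, wronskian y z x = 1 := fun x => by
    rw [hys.wronskian_eq hP.locallyIntegrable hz x₀ x, wronskian, hz0, hz1]
    simp [hx₀]
  obtain ⟨Cz, hCz⟩ := hz.exists_linear_bound hP hP1
  obtain ⟨-, -, hyd, -⟩ := hys.exists_tendsto_of_bounded hP hP1 hCy
  have hyp := hρ.tendsto_deriv_div hV.integrable hyd hξ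
  have hym : Tendsto (fun ε : ℝ => deriv y (-ξ ε) / ε) (𝓝[>] 0) (𝓝 0) := by
    have hP1' : Integrable fun t : ℝ => (t : ℂ) * ((V (-t) : ℂ) - (0 : ℂ) ^ 2) := by
      simpa using hP1.comp_neg.neg
    obtain ⟨-, -, h1, -⟩ :=
      hys.comp_neg.exists_tendsto_of_bounded hP.comp_neg hP1' (fun x => hCy (-x))
    have h2 := (hρ.comp_neg.tendsto_deriv_div hV.integrable.comp_neg h1 hξ).neg
    rw [neg_zero] at h2
    refine h2.congr fun ε => ?_
    rw [deriv_comp_neg]; ring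
  have hεξ := hρ.tendsto_mul_cutoff hξ
  have hpos : ∀ᶠ ε in 𝓝[>] (0 : ℝ), 0 < ε := eventually_mem_nhdsWithin
  have hloc : ∀ ε, LocallyIntegrable
      (fun x => (truncatedPotential V ε (ε * ξ ε) x : ℂ) - k ^ 2) volume :=
    fun ε => locallyIntegrable_truncated hV.integrable _ _ _
  -- the Jost solutions, chosen for all `ε` at once
  have hchoice : ∀ ε, ∃ f : ℝ → ℂ, HasJostCoefficients
      (IsSchrodingerSolution (truncatedPotential V ε (ε * ξ ε)) k) k (ε * ξ ε) (a ε) (b ε) →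
      IsLinearSolution (fun x => (truncatedPotential V ε (ε * ξ ε) x : ℂ) - k ^ 2) f ∧
        AsympRight k f ∧ Set.EqOn f (freeWave k (a ε) (b ε)) (Set.Iio (-(ε * ξ ε))) := by
    intro ε
    by_cases h : HasJostCoefficients
      (IsSchrodingerSolution (truncatedPotential V ε (ε * ξ ε)) k) k (ε * ξ ε) (a ε) (b ε)
    · obtain ⟨f, hf⟩ := h
      exact ⟨f, fun _ => ⟨hf.1, hf.2.1, fun x hx => hf.2.2 x hx⟩⟩
    · exact ⟨0, fun h' => absurd h' h⟩
  choose f hf using hchoice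
  have hf : ∀ᶠ ε in 𝓝[>] (0 : ℝ), _ := hab.mono hf
  have hright : ∀ᶠ ε in 𝓝[>] (0 : ℝ), f ε (ε * ξ ε) = planeWave k (ε * ξ ε) ∧
      deriv (f ε) (ε * ξ ε) = deriv (planeWave k) (ε * ξ ε) := by
    filter_upwards [hf] with ε h
    exact (h.1.asympRight_iff hk (hloc ε) truncatedPotential_right).1 h.2.1
  have hderiv : ∀ᶠ ε in 𝓝[>] (0 : ℝ), ∀ s,
      deriv (fun s => f ε (ε * s)) s / ε = deriv (f ε) (ε * s) := by
    filter_upwards [hpos] with ε h s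
    have h' : (ε : ℂ) ≠ 0 := by exact_mod_cast h.ne'
    rw [deriv_comp_mul_left, Complex.real_smul, mul_div_cancel_left₀ _ h']
  have hwave : ∀ k : ℂ, Tendsto (fun ε => planeWave k (ε * ξ ε)) (𝓝[>] 0) (𝓝 1) := fun k => by
    have := ((continuous_planeWave k).tendsto 0).comp hεξ
    rwa [planeWave_zero_right] at this
  have hwave' : ∀ k : ℂ, Tendsto (fun ε => planeWave k (-(ε * ξ ε))) (𝓝[>] 0) (𝓝 1) := fun k => by
    have h1 := hεξ.neg
    rw [neg_zero] at h1
    have := ((continuous_planeWave k).tendsto 0).comp h1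
    rwa [planeWave_zero_right] at this
  obtain ⟨hlim0, hlim1⟩ := tendsto_cauchyData (k := k) (d := Complex.I * k)
    (Q := fun ε s => (ε : ℂ) ^ 2 * ((truncatedPotential V ε (ε * ξ ε) (ε * s) : ℂ) - k ^ 2))
    (u := fun ε s => f ε (ε * s)) hP hys hz hW hCy hCz hcm0 hcp0 hcm hcp (hρ.tendsto_cutoff hξ)
    hεξ hyp hym (hpos.mono fun ε h => locallyIntegrable_rescaled (hloc ε) h.ne')
    (hpos.mono fun ε h s hs => sq_mul_truncatedPotential h hs) (hf.mono fun ε h => h.1.comp_mul ε)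
    ((hwave k).congr' (hright.mono fun ε h => h.1.symm))
    (by
      have h1 := (hwave k).const_mul (Complex.I * k)
      rw [mul_one] at h1
      refine h1.congr' ?_
      filter_upwards [hright, hderiv] with ε h2 h3
      rw [h3, h2.2, (hasDerivAt_planeWave k _).deriv])
  have hlim1' : Tendsto (fun ε => deriv (f ε) (-(ε * ξ ε)) / (Complex.I * k)) (𝓝[>] 0)
      (𝓝 (cp / cm)) := by
    have h1 := hlim1.div_const (Complex.I * k)
    rw [mul_div_cancel_right₀ _ hIk] at h1
    refine h1.congr' ?_
    filter_upwards [hderiv] with ε h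
    rw [h, mul_neg]
  simp only [mul_neg] at hlim0
  have hleft : ∀ᶠ ε in 𝓝[>] (0 : ℝ), f ε (-(ε * ξ ε)) = freeWave k (a ε) (b ε) (-(ε * ξ ε)) ∧
      deriv (f ε) (-(ε * ξ ε)) = deriv (freeWave k (a ε) (b ε)) (-(ε * ξ ε)) := by
    filter_upwards [hf] with ε h
    exact h.1.cauchyData_eq (hloc ε) isOpen_Iio h.2.2 (by simp)
  constructor
  · have h1 := ((hlim0.add hlim1').div_const 2).mul (hwave' (-k))
    rw [mul_one] at h1
    refine h1.congr' ?_
    filter_upwards [hleft] with ε h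
    rw [h.1, h.2]
    exact (freeWave_coefficients hk (a ε) (b ε) (-(ε * ξ ε))).1.symm
  · have h1 := ((hlim0.sub hlim1').div_const 2).mul (hwave' k)
    rw [mul_one] at h1
    refine h1.congr' ?_
    filter_upwards [hleft] with ε h
    rw [h.1, h.2]
    exact (freeWave_coefficients hk (a ε) (b ε) (-(ε * ξ ε))).2.symm

theorem corollary4p2 (V : ℝ → ℝ) (hV : FaddeevMarchenko V) (hres : IsResonant V) :
    ∃ θ : ℝ, θ ≠ 0 ∧
      -- the ratio is well defined: it is the same for every half-bound state
      (∀ y : ℝ → ℂ, IsHalfBoundState V y →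
        ∃ cm cp : ℂ, cm ≠ 0 ∧ cp ≠ 0 ∧ Tendsto y atBot (𝓝 cm) ∧ Tendsto y atTop (𝓝 cp) ∧
          (θ : ℂ) = cp / cm) ∧
      -- equivalently, it is the ratio of the Jost solutions at zero energy
      (∃ fp fm : ℝ → ℂ, IsRightJost V 0 fp ∧ IsLeftJost V 0 fm ∧ ∀ x, fm x = θ * fp x) ∧
      -- limits of the scattering coefficients of the truncated operators
      (∀ ρ : ℝ → ℝ, IsCutoffWeight V ρ →
        ∀ ξ : ℝ → ℝ, (∀ᶠ ε in 𝓝[>] (0 : ℝ), 0 < ξ ε ∧ ρ (ξ ε) = 1 / ε) →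
        ∀ k : ℂ, k ≠ 0 →
          (∀ᶠ ε in 𝓝[>] (0 : ℝ), ∃! p : ℂ × ℂ,
            HasJostCoefficients
              (IsSchrodingerSolution (truncatedPotential V ε (ε * ξ ε)) k) k (ε * ξ ε) p.1 p.2) ∧
          ∀ a b : ℝ → ℂ,
            (∀ᶠ ε in 𝓝[>] (0 : ℝ),
              HasJostCoefficients
                (IsSchrodingerSolution (truncatedPotential V ε (ε * ξ ε)) k) k (ε * ξ ε)
                (a ε) (b ε)) →
            (∀ᶠ ε in 𝓝[>] (0 : ℝ), a ε ≠ 0) ∧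
            Tendsto (fun ε => b ε / a ε) (𝓝[>] 0)
              (𝓝 ((1 - (θ : ℂ) ^ 2) / (1 + (θ : ℂ) ^ 2))) ∧
            Tendsto (fun ε => 1 / a ε) (𝓝[>] 0)
              (𝓝 (2 * (θ : ℂ) / (1 + (θ : ℂ) ^ 2)))) ∧
      -- these limits are the scattering coefficients of `S(θ)`
      (∀ k : ℂ, k ≠ 0 →
        (∃ a b : ℂ, HasJostCoefficients (IsPointInteractionSolution θ k) k 0 a b) ∧
        ∀ a b : ℂ, HasJostCoefficients (IsPointInteractionSolution θ k) k 0 a b →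
          a ≠ 0 ∧ b / a = (1 - (θ : ℂ) ^ 2) / (1 + (θ : ℂ) ^ 2) ∧
          1 / a = 2 * (θ : ℂ) / (1 + (θ : ℂ) ^ 2)) := by
  obtain ⟨y, hy⟩ := hres
  obtain ⟨θ, cm, cp, hθ0, hcm0, hcp0, hcm, hcp, hθ, hratio⟩ := exists_halfBoundState_ratio hV hy
  have hθ0' : (θ : ℂ) ≠ 0 := by exact_mod_cast hθ0
  have hθinv : cm / cp = (θ : ℂ)⁻¹ := by rw [hθ, inv_div]
  have hsum : 1 + (θ : ℂ) ^ 2 ≠ 0 := by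
    have : (0 : ℝ) < 1 + θ ^ 2 := by positivity
    exact_mod_cast this.ne'
  refine ⟨θ, hθ0, hratio, ?_, ?_, ?_⟩
  · have hys : IsLinearSolution (fun t => (V t : ℂ) - (0 : ℂ) ^ 2) y := hy.1
    refine ⟨fun x => cp⁻¹ * y x, fun x => cm⁻¹ * y x, ⟨hys.const_mul _, ?_⟩,
      ⟨hys.const_mul _, ?_⟩, fun x => ?_⟩
    · have h1 := (hcp.const_mul cp⁻¹).sub_const 1
      rw [inv_mul_cancel₀ hcp0, sub_self] at h1
      simpa [AsympRight, planeWave] using h1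
    · have h1 := (hcm.const_mul cm⁻¹).sub_const 1
      rw [inv_mul_cancel₀ hcm0, sub_self] at h1
      simpa [AsympLeft, planeWave] using h1
    · rw [hθ]; field_simp
  · intro ρ hρ ξ hξ k hk
    refine ⟨Eventually.of_forall fun ε => IsLinearSolution.existsUnique_jostCoefficients hk
      (locallyIntegrable_truncated hV.integrable _ _ _) truncatedPotential_right
      truncatedPotential_left, fun a b hab => ?_⟩
    obtain ⟨ha, hb⟩ := tendsto_jostCoefficients hV hy hcm0 hcp0 hcm hcp hρ hξ hk hab
    rw [hθinv, ← hθ] at ha hb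
    have ha' : ((θ : ℂ)⁻¹ + θ) / 2 = (1 + (θ : ℂ) ^ 2) / (2 * θ) := by field_simp
    have hb' : ((θ : ℂ)⁻¹ - θ) / 2 = (1 - (θ : ℂ) ^ 2) / (2 * θ) := by field_simp
    rw [ha'] at ha
    rw [hb'] at hb
    have ha0 : (1 + (θ : ℂ) ^ 2) / (2 * θ) ≠ 0 := div_ne_zero hsum (by simpa using hθ0)
    refine ⟨ha.eventually_ne ha0, ?_, ?_⟩
    · have h1 := hb.div ha ha0
      rwa [div_div_div_cancel_right₀ (by simpa using hθ0)] at h1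
    · have h1 := (tendsto_const_nhds (x := (1 : ℂ))).div ha ha0
      rwa [one_div_div] at h1
  · intro k hk
    refine ⟨⟨_, _, (IsPointInteractionSolution.jostCoefficients_iff hθ0 hk).2 ⟨rfl, rfl⟩⟩,
      fun a b hab => ?_⟩
    obtain ⟨rfl, rfl⟩ := (IsPointInteractionSolution.jostCoefficients_iff hθ0 hk).1 hab
    refine ⟨div_ne_zero hsum (by simpa using hθ0), ?_, one_div_div _ _⟩
    rw [div_div_div_cancel_right₀ (by simpa using hθ0)]
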